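/- Let $f,h_1,\dots,h_p\colon\mathbb R^n\times\mathbb R^m\to\mathbb R$ be continuously differentiable, $I=\{1,\dots,\ell\}$, $J=\{\ell+1,\dots,p\}$, and for $x\in\mathbb R^n$ put $$\Gamma(x)=\{y: h_i(x,y)\le 0\ (i\in I),\ h_i(x,y)=0\ (i\in J)\},\quad \varphi(x)=\inf_{y\in\Gamma(x)}f(x,y)\in\overline{\mathbb R},\quad S(x)=\operatorname*{argmin}_{y\in\Gamma(x)}f(x,y),$$ with $\inf\varnothing=+\infty$. Put $h_0(x,y)=f(x,y)-\varphi(x)$, so that $S(x)=\{y: h_i(x,y)\le0\ (i\in I\cup\{0\}),\ h_i(x,y)=0\ (i\in J)\}$. All norms are Euclidean, $\mathbb B$ is the closed unit ball, and $\operatorname{dist}(y,\varnothing)=+\infty$. Let $\bar y\in S(\bar x)$. * $S$ is *R-regular* at $(\bar x,\bar y)$ if there are $\kappa>0$ and a neighborhood $U$ of $(\bar x,\bar y)$ such that for all $(x,y)\in U$ $$\operatorname{dist}(y,S(x))\le\kappa\max\Bigl\{0,\ \max_{i\in I\cup\{0\}}h_i(x,y),\ \max_{i\in J}|h_i(x,y)|\Bigr\}.$$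 * $S$ has the *Aubin property* at $(\bar x,\bar y)$ if there are neighborhoods $U$ of $\bar x$, $V$ of $\bar y$ and $\kappa>0$ with $S(x)\cap V\subset S(x')+\kappa\|x-x'\|\mathbb B$ for all $x,x'\in U$. * $S$ is *inner semicontinuous* at $(\bar x,\bar y)$ if for every sequence $x^k\to\bar x$ there is a sequence $y^k\to\bar y$ with $y^k\in S(x^k)$ for all large $k$. * A pair of finite families of vectors $((a^i)_{i\in A},(b^i)_{i\in B})$ is *positive-linearly dependent* if $\sum_{i\in A}\alpha_ia^i+\sum_{i\in B}\beta_ib^i=0$ for some reals $\alpha_i\ge0$ and $\beta_i$, not all zero. * *RCPLD$_S$* holds at $(\bar x,\bar y)$ if there are a neighborhood $U$ of $(\bar x,\bar y)$ and a set $T\subset J$ such that (i) the family $(\nabla_yh_i(\bar x,\bar y))_{i\in T}$ is a basis of the span of $(\nabla_yh_i(\bar x,\bar y))_{i\in J}$; (ii) the family $(\nabla_yh_i(x,y))_{i\in J}$ has constant rank for $(x,y)\in U$; (iii) for each $K\subset\{i\in I\cup\{0\}: h_i(\bar x,\bar y)=0\}$ such that the pair of families $((\nabla_yh_i(\bar x,\bar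 y))_{i\in K},(\nabla_yh_i(\bar x,\bar y))_{i\in T})$ is positive-linearly dependent, the family $(\nabla_yh_i(x,y))_{i\in K\cup T}$ is linearly dependent for every $(x,y)\in U$. (Here $\nabla_yh_0(x,y)=\nabla_yf(x,y)$ where $\varphi(x)$ is finite.) **Theorem.** Let $\bar x\in\mathbb R^n$ with $\Gamma(\bar x)\ne\varnothing$. (a) Assume that for each $x\in\mathbb R^n$ the functions $f(x,\cdot)$ and $h_i(x,\cdot)$, $i\in I$, are convex and $h_i(x,\cdot)$, $i\in J$, are affine; that $\Gamma$ is locally bounded at $\bar x$, i.e. $\bigcup_{x\in W}\Gamma(x)$ is bounded for some neighborhood $W$ of $\bar x$; that RCPLD$_S$ holds at each point of $\{\bar x\}\times S(\bar x)$; and that $\varphi$ is continuous at $\bar x$. Then $S$ is R-regular and has the Aubin property at each point of $\{\bar x\}\times S(\bar x)$. (b) Let $\bar y\in S(\bar x)$ be such that $S$ is inner semicontinuous at $(\bar x,\bar y)$ and RCPLD$_S$ holds at $(\bar x,\bar y)$. Then $S$ is R-regular and has the Aubin property at $(\bar x,\bar y)$. -/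

import Mathlib

open Set Filter Topology
open scoped ENNReal Pointwise

noncomputable section

/-- `ℝⁿ` with the Euclidean norm. -/
abbrev Euc (n : ℕ) : Type := EuclideanSpace ℝ (Fin n)

/-- Positive-linear dependence of a pair of finite families of vectors: there are coefficients,
nonnegative on the first family and free on the second one, not all of them zero, such that the
corresponding combination vanishes. -/
def PosLinDep {V ι κ : Type*} [AddCommGroup V] [Module ℝ V] [Fintype ι] [Fintype κ]
    (a : ι → V) (b : κ → V) : Prop :=
  ∃ (α : ι → ℝ) (β : κ → ℝ), (∀ i, 0 ≤ α i) ∧ ((∃ i, α i ≠ 0) ∨ (∃ j, β j ≠ 0)) ∧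
    ∑ i, α i • a i + ∑ j, β j • b j = 0

section SetValued

variable {n m : ℕ}

/-- Local boundedness of a set-valued mapping at `x₀`. -/
def LocallyBoundedAt (Υ : Euc n → Set (Euc m)) (x₀ : Euc n) : Prop :=
  ∃ B : Set (Euc m), Bornology.IsBounded B ∧ ∃ U ∈ 𝓝 x₀, ∀ x ∈ U, Υ x ⊆ B

/-- Inner semicontinuity of a set-valued mapping at the point `(x₀, y₀)`. -/
def InnerSemicontinuousAt (Υ : Euc n → Set (Euc m)) (x₀ : Euc n) (y₀ : Euc m) : Prop :=
  ∀ x : ℕ → Euc n, Tendsto x atTop (𝓝 x₀) →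
    ∃ y : ℕ → Euc m, Tendsto y atTop (𝓝 y₀) ∧ ∀ᶠ k in atTop, y k ∈ Υ (x k)

/-- The Aubin property of a set-valued mapping at the point `(x₀, y₀)`. -/
def AubinAt (Υ : Euc n → Set (Euc m)) (x₀ : Euc n) (y₀ : Euc m) : Prop :=
  ∃ U ∈ 𝓝 x₀, ∃ V ∈ 𝓝 y₀, ∃ κ : ℝ, 0 < κ ∧ ∀ x ∈ U, ∀ x' ∈ U,
    Υ x ∩ V ⊆ Υ x' + Metric.closedBall (0 : Euc m) (κ * ‖x - x'‖)

end SetValued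

section Systems

/-! Parametric systems `g i x y ≤ 0`, `h j x y = 0` with finitely many extended-real-valued
constraint functions. -/

variable {n m : ℕ} {ι κ : Type*}

/-- The partial gradient `∇_y h(x, y)` of an extended-real-valued function; it is the usual
gradient where `h(x, ·)` is finite. -/
def gradY (h : Euc n → Euc m → EReal) (x : Euc n) (y : Euc m) : Euc m :=
  gradient (fun y' => (h x y').toReal) y

/-- `max {0, max_i g_i(x, y), max_j |h_j(x, y)|}` as an element of `[0, ∞]`
(`EReal.toENNReal` is the positive part). -/
def constraintResidual (g : ι → Euc n → Euc m → EReal) (h : κ → Euc n → Euc m → EReal)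
    (x : Euc n) (y : Euc m) : ℝ≥0∞ :=
  max (⨆ i, (g i x y).toENNReal) (⨆ j, (h j x y).abs)

/-- R-regularity at `(x₀, y₀)` of the set-valued mapping `Υ` that is described by the system
`g i x y ≤ 0`, `h j x y = 0`. The distance to the empty set is `∞`. -/
def RRegularAt (Υ : Euc n → Set (Euc m))
    (g : ι → Euc n → Euc m → EReal) (h : κ → Euc n → Euc m → EReal)
    (x₀ : Euc n) (y₀ : Euc m) : Prop :=
  ∃ c : ℝ, 0 < c ∧ ∃ U ∈ 𝓝 (x₀, y₀), ∀ z ∈ U,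
    Metric.infEDist z.2 (Υ z.1) ≤ ENNReal.ofReal c * constraintResidual g h z.1 z.2

/-- The relaxed constant positive linear dependence constraint qualification (RCPLD) of the
system `g i x y ≤ 0`, `h j x y = 0` at `(x₀, y₀)`. -/
def RCPLDAt (g : ι → Euc n → Euc m → EReal) (h : κ → Euc n → Euc m → EReal)
    (x₀ : Euc n) (y₀ : Euc m) : Prop :=
  ∃ U ∈ 𝓝 (x₀, y₀), ∃ T : Finset κ,
    (LinearIndependent ℝ (fun j : T => gradY (h j) x₀ y₀) ∧
      Submodule.span ℝ (range fun j : T => gradY (h j) x₀ y₀) =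
        Submodule.span ℝ (range fun j : κ => gradY (h j) x₀ y₀)) ∧
    (∃ r : ℕ, ∀ z ∈ U,
      Module.finrank ℝ (Submodule.span ℝ (range fun j : κ => gradY (h j) z.1 z.2)) = r) ∧
    ∀ K : Finset ι, (∀ i ∈ K, g i x₀ y₀ = 0) →
      PosLinDep (fun i : K => gradY (g i) x₀ y₀) (fun j : T => gradY (h j) x₀ y₀) →
      ∀ z ∈ U, ¬ LinearIndependent ℝ
        (Sum.elim (fun i : K => gradY (g i) z.1 z.2) (fun j : T => gradY (h j) z.1 z.2))

end Systems

section ParametricOptimization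

/-! The problem of minimizing `f x y` over `y` subject to `g i x y ≤ 0`, `h j x y = 0`. -/

variable {n m : ℕ} {ι κ : Type*}

/-- The feasible set mapping `Γ`. -/
def feasibleMap (g : ι → Euc n → Euc m → ℝ) (h : κ → Euc n → Euc m → ℝ) (x : Euc n) :
    Set (Euc m) :=
  {y | (∀ i, g i x y ≤ 0) ∧ ∀ j, h j x y = 0}

/-- The solution mapping `S`. -/
def solutionMap (f : Euc n → Euc m → ℝ) (g : ι → Euc n → Euc m → ℝ)
    (h : κ → Euc n → Euc m → ℝ) (x : Euc n) : Set (Euc m) :=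
  {y | y ∈ feasibleMap g h x ∧ ∀ z ∈ feasibleMap g h x, f x y ≤ f x z}

/-- The optimal value function `φ`, with `inf ∅ = +∞`. -/
def optimalValue (f : Euc n → Euc m → ℝ) (g : ι → Euc n → Euc m → ℝ)
    (h : κ → Euc n → Euc m → ℝ) (x : Euc n) : EReal :=
  ⨅ y ∈ feasibleMap g h x, (f x y : EReal)

/-- The inequality constraint functions of the description of `S`: the function
`h₀ = f - φ` (index `none`) together with the `g i`. -/
def solIneq (f : Euc n → Euc m → ℝ) (g : ι → Euc n → Euc m → ℝ)
    (h : κ → Euc n → Euc m → ℝ) : Option ι → Euc n → Euc m → EReal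
  | none => fun x y => (f x y : EReal) - optimalValue f g h x
  | some i => fun x y => (g i x y : EReal)

/-- The equality constraint functions of the description of `S`. -/
def solEq (h : κ → Euc n → Euc m → ℝ) : κ → Euc n → Euc m → EReal :=
  fun j x y => (h j x y : EReal)

/-- `S` is the solution set of the system `solIneq ≤ 0`, `solEq = 0`. -/
theorem mem_solutionMap_iff (f : Euc n → Euc m → ℝ) (g : ι → Euc n → Euc m → ℝ)
    (h : κ → Euc n → Euc m → ℝ) (x : Euc n) (y : Euc m) :
    y ∈ solutionMap f g h x ↔
      (∀ i, solIneq f g h i x y ≤ 0) ∧ ∀ j, solEq h j x y = 0 := by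
  have key : (f x y : EReal) - optimalValue f g h x ≤ 0 ↔
      ∀ z ∈ feasibleMap g h x, f x y ≤ f x z := by
    rw [EReal.sub_nonpos]
    simp [optimalValue]
  have coe_nonpos : ∀ r : ℝ, (r : EReal) ≤ 0 ↔ r ≤ 0 := fun r => by
    rw [← EReal.coe_zero, EReal.coe_le_coe_iff]
  simp only [Option.forall, solIneq, solEq, key, EReal.coe_eq_zero, coe_nonpos]
  constructor
  · rintro ⟨⟨h1, h2⟩, h3⟩
    exact ⟨⟨h3, h1⟩, h2⟩
  · rintro ⟨⟨h3, h1⟩, h2⟩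
    exact ⟨⟨h1, h2⟩, h3⟩

end ParametricOptimization

end

/-! Everything rests on a bound for the distance from y to its projection w on a parametric set {g ≤
0, h = 0}. Penalization gives points v near w where y - w, up to 2(v - w), is a combination of
constraint gradients, with positive weights only on inequalities violated at v. RCPLD bounds such
weights by the norm of the combination: Carathéodory's theorem passes to a linearly independent
subfamily, condition (iii) then excludes positive-linear dependence of that subfamily at the base
point, and positive-linear independence there bounds coefficients uniformly nearby. Pairing with y -
v and letting v tend to w gives ‖y - w‖ ≤ M (r + η‖y - w‖), where r is the violation at y and η the
linearization error (`GradientSystem.exists_projection_bound`).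

If the set has points near y₀ for every x near x₀, then w is close to y₀, so η can be made small and
absorbed. The resulting local error bound is R-regularity; for S it only needs φ to be continuous at
x₀ (`GradientSystem.exists_error_bound`). The Aubin property needs f - φ to be Lipschitz in x. RCPLD
passes from S to Γ by dropping h₀, and the error bound for Γ moves a minimizer at x to a feasible
point at x' at cost O(‖x - x'‖), which makes φ locally Lipschitz (`exists_abs_optimalValue_sub_le`).

Part (a) reduces to (b). For convex data η = 0, so the projection bound holds however far y is from
w. Projections of y₀ onto S(x_k) cluster at some point of S(x₀), where RCPLD is available, and the
bound forces them to converge to y₀ (`GradientSystem.eventually_nonempty_inter_of_convex`). -/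

/-! ### Bounded multipliers from constant positive linear dependence. -/

section Multipliers

variable {Z V ι κ : Type*} [TopologicalSpace Z] [NormedAddCommGroup V] [NormedSpace ℝ V]

/-- Positive-linear independence is stable, with a uniform bound on the coefficients. -/
theorem exists_coeff_bound_of_not_posLinDep [Fintype ι] [Fintype κ]
    {a : ι → Z → V} {b : κ → Z → V} {z₀ : Z}
    (ha : ∀ i, ContinuousAt (a i) z₀) (hb : ∀ j, ContinuousAt (b j) z₀)
    (hn : ¬ PosLinDep (fun i => a i z₀) (fun j => b j z₀)) :
    ∃ c : ℝ, 0 < c ∧ ∀ᶠ z in 𝓝 z₀, ∀ (α : ι → ℝ) (β : κ → ℝ), (∀ i, 0 ≤ α i) →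
      c * ‖(α, β)‖ ≤ ‖∑ i, α i • a i z + ∑ j, β j • b j z‖ := by
  let F : Z → (ι → ℝ) × (κ → ℝ) → ℝ := fun z p =>
    ‖∑ i, p.1 i • a i z + ∑ j, p.2 j • b j z‖
  have hF : ∀ p, ContinuousAt (fun q : Z × ((ι → ℝ) × (κ → ℝ)) => F q.1 q.2) (z₀, p) := by
    intro p
    refine ContinuousAt.norm (ContinuousAt.add ?_ ?_)
    · refine tendsto_finsetSum _ fun i _ => ContinuousAt.smul ?_ ?_
      · fun_prop
      · exact ContinuousAt.comp (f := Prod.fst) (x := (z₀, p)) (ha i) continuousAt_fst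
    · refine tendsto_finsetSum _ fun j _ => ContinuousAt.smul ?_ ?_
      · fun_prop
      · exact ContinuousAt.comp (f := Prod.fst) (x := (z₀, p)) (hb j) continuousAt_fst
  -- By positive homogeneity it suffices to treat normalized coefficients, which form a compact set.
  let D : Set ((ι → ℝ) × (κ → ℝ)) := Metric.sphere 0 1 ∩ {p | ∀ i, 0 ≤ p.1 i}
  have hD : IsCompact D := by
    refine (isCompact_sphere _ _).inter_right ?_
    simp only [ofPred_forall]
    exact isClosed_iInter fun i => isClosed_le continuous_const (by fun_prop)
  have hpos : ∀ p ∈ D, 0 < F z₀ p := by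
    rintro p ⟨hp1, hp2⟩
    refine (norm_nonneg _).lt_of_ne fun h0 => hn ⟨p.1, p.2, hp2, ?_, norm_eq_zero.1 h0.symm⟩
    by_contra hcon
    push Not at hcon
    have : p = 0 := Prod.ext (funext hcon.1) (funext hcon.2)
    simp [this] at hp1
  obtain ⟨c, hc, hcD⟩ : ∃ c : ℝ, 0 < c ∧ ∀ p ∈ D, c < F z₀ p := by
    rcases D.eq_empty_or_nonempty with hE | hE
    · exact ⟨1, one_pos, by simp [hE]⟩
    · have hFc : ContinuousOn (F z₀) D := fun p _ =>
        (ContinuousAt.comp (f := fun p => (z₀, p)) (x := p) (hF p)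
          (by fun_prop)).continuousWithinAt
      obtain ⟨p, hp, hmin⟩ := hD.exists_isMinOn hE hFc
      exact ⟨F z₀ p / 2, half_pos (hpos p hp), fun q hq =>
        (half_lt_self (hpos p hp)).trans_le (hmin hq)⟩
  refine ⟨c, hc, ?_⟩
  have hev := hD.eventually_forall_of_forall_eventually (x₀ := z₀)
    (P := fun z p => c < F z p) (fun p hp => (hF p).eventually_const_lt (hcD p hp))
  filter_upwards [hev] with z hz α β hα
  rcases eq_or_ne (α, β) 0 with h0 | h0
  · rw [h0]; simp
  · have hnp : 0 < ‖(α, β)‖ := norm_pos_iff.2 h0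
    have hmem : ‖(α, β)‖⁻¹ • (α, β) ∈ D := by
      refine ⟨?_, fun i => ?_⟩
      · rw [mem_sphere_zero_iff_norm, norm_smul, norm_inv, norm_norm, inv_mul_cancel₀ hnp.ne']
      · exact mul_nonneg (inv_nonneg.2 hnp.le) (hα i)
    have h1 : F z (‖(α, β)‖⁻¹ • (α, β)) =
        ‖(α, β)‖⁻¹ * ‖∑ i, α i • a i z + ∑ j, β j • b j z‖ := by
      rw [← Real.norm_of_nonneg (inv_nonneg.2 hnp.le), ← norm_smul, smul_add, Finset.smul_sum,
        Finset.smul_sum]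
      simp only [F, Prod.smul_fst, Prod.smul_snd, Pi.smul_apply, smul_eq_mul, mul_smul,
        norm_inv, norm_norm]
    have h2 := (hz _ hmem).le
    rw [h1, inv_mul_eq_div, le_div_iff₀ hnp] at h2
    exact h2

/-- Conic Carathéodory theorem relative to a linearly independent family `b` with free
coefficients. -/
theorem exists_nonneg_repr_linearIndependent [Fintype κ] {V : Type*} [AddCommGroup V]
    [Module ℝ V] (a : ι → V) {b : κ → V} (hb : LinearIndependent ℝ b) (v : V) (s : Finset ι) :
    ∀ c : ι → ℝ, (∀ i ∈ s, 0 ≤ c i) →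
      v - ∑ i ∈ s, c i • a i ∈ Submodule.span ℝ (range b) →
      ∃ K ⊆ s, ∃ c' : ι → ℝ, (∀ i ∈ K, 0 ≤ c' i) ∧
        v - ∑ i ∈ K, c' i • a i ∈ Submodule.span ℝ (range b) ∧
        LinearIndependent ℝ (Sum.elim (fun i : K => a i) b) := by
  classical
  induction s using Finset.strongInduction with
  | H s ih =>
    intro c hc hv
    by_cases hli : LinearIndependent ℝ (Sum.elim (fun i : s => a i) b)
    · exact ⟨s, subset_rfl, c, hc, hv, hli⟩
    -- A linear relation modulo the span of `b`. Independence of `b` makes some `w i` nonzero, and a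
    -- change of sign makes it positive.
    obtain ⟨w, hw, hwne⟩ : ∃ w : ι → ℝ,
        ∑ i ∈ s, w i • a i ∈ Submodule.span ℝ (range b) ∧ ∃ i ∈ s, 0 < w i := by
      obtain ⟨u, hu, k, hk⟩ := Fintype.not_linearIndependent_iff.1 hli
      rw [Fintype.sum_sum_type] at hu
      simp only [Sum.elim_inl, Sum.elim_inr] at hu
      let w : ι → ℝ := fun i => if h : i ∈ s then u (Sum.inl ⟨i, h⟩) else 0
      have hsum : ∑ i ∈ s, w i • a i = ∑ i : s, u (Sum.inl i) • a i := by
        rw [← Finset.sum_coe_sort]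
        exact Finset.sum_congr rfl fun i _ => by simp [w]
      have hspan : ∑ i ∈ s, w i • a i ∈ Submodule.span ℝ (range b) := by
        rw [hsum, eq_neg_of_add_eq_zero_left hu]
        exact neg_mem (sum_mem fun j _ =>
          Submodule.smul_mem _ _ (Submodule.subset_span (mem_range_self j)))
      have hex : ∃ i ∈ s, w i ≠ 0 := by
        by_contra hcon
        push Not at hcon
        rw [← hsum, Finset.sum_eq_zero fun i hi => by rw [hcon i hi, zero_smul], zero_add] at hu
        have h0 := Fintype.linearIndependent_iff.1 hb _ hu
        rcases k with k | k
        · exact hk (by simpa [w] using hcon k k.2)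
        · exact hk (h0 k)
      obtain ⟨i, his, hi⟩ := hex
      rcases hi.lt_or_gt with h | h
      · refine ⟨-w, ?_, i, his, by simpa using h⟩
        simpa [Finset.sum_neg_distrib] using neg_mem hspan
      · exact ⟨w, hspan, i, his, h⟩
    obtain ⟨i₁, hi₁, hi₁pos⟩ := hwne
    -- Ratio test: the largest multiple of `w` that can be subtracted from `c` without losing
    -- nonnegativity; it cancels the coefficient at `i₀`.
    obtain ⟨i₀, hi₀, hmin⟩ := (s.filter fun i => 0 < w i).exists_min_image (fun i => c i / w i)
      ⟨i₁, Finset.mem_filter.2 ⟨hi₁, hi₁pos⟩⟩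
    obtain ⟨hi₀s, hi₀pos⟩ := Finset.mem_filter.1 hi₀
    set t := c i₀ / w i₀ with ht
    have ht0 : 0 ≤ t := div_nonneg (hc _ hi₀s) hi₀pos.le
    have hnn : ∀ i ∈ s, 0 ≤ c i - t * w i := by
      intro i hi
      rcases le_or_gt (w i) 0 with h | h
      · nlinarith [hc i hi, mul_nonneg ht0 (neg_nonneg.2 h)]
      · have := hmin i (Finset.mem_filter.2 ⟨hi, h⟩)
        rw [le_div_iff₀ h] at this
        linarith
    have hzero : c i₀ - t * w i₀ = 0 := by rw [ht, div_mul_cancel₀ _ hi₀pos.ne', sub_self]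
    obtain ⟨K, hK, c', h1, h2, h3⟩ := ih (s.erase i₀) (Finset.erase_ssubset hi₀s)
      (fun i => c i - t * w i) (fun i hi => hnn i (Finset.mem_of_mem_erase hi)) (by
        have : ∑ i ∈ s.erase i₀, (c i - t * w i) • a i =
            ∑ i ∈ s, c i • a i - t • ∑ i ∈ s, w i • a i := by
          rw [Finset.sum_erase _ (by rw [hzero, zero_smul]), Finset.smul_sum,
            ← Finset.sum_sub_distrib]
          exact Finset.sum_congr rfl fun i _ => by rw [sub_smul, mul_smul]
        rw [this, sub_sub_eq_add_sub, add_sub_right_comm]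
        exact add_mem hv (Submodule.smul_mem _ _ hw))
    exact ⟨K, hK.trans (Finset.erase_subset _ _), c', h1, h2, h3⟩

/-- The relaxed constant positive linear dependence condition for families of vectors depending
on a parameter; `act` is the set of active indices of the first family. -/
def RelaxedConstPosLinDep (act : Set ι) (a : ι → Z → V) (b : κ → Z → V) (z₀ : Z) : Prop :=
  ∃ U ∈ 𝓝 z₀, ∃ T : Finset κ,
    (LinearIndependent ℝ (fun j : T => b j z₀) ∧
      Submodule.span ℝ (range fun j : T => b j z₀) =
        Submodule.span ℝ (range fun j : κ => b j z₀)) ∧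
    (∃ r : ℕ, ∀ z ∈ U,
      Module.finrank ℝ (Submodule.span ℝ (range fun j : κ => b j z)) = r) ∧
    ∀ K : Finset ι, (∀ i ∈ K, i ∈ act) →
      PosLinDep (fun i : K => a i z₀) (fun j : T => b j z₀) →
      ∀ z ∈ U, ¬ LinearIndependent ℝ
        (Sum.elim (fun i : K => a i z) (fun j : T => b j z))

/-- Under the relaxed constant positive linear dependence condition, combinations of the vectors
can be rewritten with coefficients that are controlled by the norm of the combination. -/
theorem RelaxedConstPosLinDep.exists_bounded_coeff [Fintype ι] [Fintype κ]
    [FiniteDimensional ℝ V] {act : Set ι} {a : ι → Z → V} {b : κ → Z → V} {z₀ : Z}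
    (H : RelaxedConstPosLinDep act a b z₀)
    (ha : ∀ i, ContinuousAt (a i) z₀) (hb : ∀ j, ContinuousAt (b j) z₀) :
    ∃ M : ℝ, 0 < M ∧ ∀ᶠ z in 𝓝 z₀, ∀ (α : ι → ℝ) (β : κ → ℝ), (∀ i, 0 ≤ α i) →
      (∀ i, α i ≠ 0 → i ∈ act) →
      ∃ (α' : ι → ℝ) (β' : κ → ℝ), (∀ i, 0 ≤ α' i) ∧ (∀ i, α i = 0 → α' i = 0) ∧
        ∑ i, α' i • a i z + ∑ j, β' j • b j z = ∑ i, α i • a i z + ∑ j, β j • b j z ∧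
        (∀ i, α' i ≤ M * ‖∑ i, α i • a i z + ∑ j, β j • b j z‖) ∧
        ∀ j, |β' j| ≤ M * ‖∑ i, α i • a i z + ∑ j, β j • b j z‖ := by
  classical
  obtain ⟨U, hU, T, ⟨hT, hTspan⟩, ⟨r, hr⟩, hK⟩ := H
  have hbound : ∀ K : Finset ι, ∃ c : ℝ, 0 < c ∧ ∀ᶠ z in 𝓝 z₀,
      ¬ PosLinDep (fun i : K => a i z₀) (fun j : T => b j z₀) →
      ∀ (α : K → ℝ) (β : T → ℝ), (∀ i, 0 ≤ α i) →
      c * ‖(α, β)‖ ≤ ‖∑ i, α i • a i z + ∑ j, β j • b j z‖ := by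
    intro K
    by_cases hP : PosLinDep (fun i : K => a i z₀) (fun j : T => b j z₀)
    · exact ⟨1, one_pos, by simp [hP]⟩
    · obtain ⟨c, hc, hc'⟩ := exists_coeff_bound_of_not_posLinDep
        (a := fun i : K => a i) (b := fun j : T => b j) (fun i => ha i) (fun j => hb j) hP
      exact ⟨c, hc, hc'.mono fun z hz _ => hz⟩
  choose c hc hcev using hbound
  have hTev : ∀ᶠ z in 𝓝 z₀, LinearIndependent ℝ (fun j : T => b j z) := by
    have : ContinuousAt (fun z => fun j : T => b j z) z₀ := continuousAt_pi.2 fun j => hb j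
    exact this.eventually hT.eventually
  have hspan : ∀ᶠ z in 𝓝 z₀, LinearIndependent ℝ (fun j : T => b j z) ∧
      ∀ j, b j z ∈ Submodule.span ℝ (range fun j : T => b j z) := by
    filter_upwards [hTev, hU] with z hz hzU
    refine ⟨hz, fun j => ?_⟩
    have hle : Submodule.span ℝ (range fun j : T => b j z) ≤
        Submodule.span ℝ (range fun j : κ => b j z) :=
      Submodule.span_mono (range_subset_iff.2 fun j => mem_range_self (f := fun j : κ => b j z) j.1)
    -- Constant rank: the `T`-subfamily stays independent near `z₀`, so it still spans by counting
    -- dimensions.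
    have heq := Submodule.eq_of_le_of_finrank_eq hle (by
      rw [hr z hzU, ← hr z₀ (mem_of_mem_nhds hU), ← hTspan, finrank_span_eq_card hz,
        finrank_span_eq_card hT])
    rw [heq]
    exact Submodule.subset_span (mem_range_self j)
  let M : ℝ := ∑ K : Finset ι, (c K)⁻¹
  have hMle : ∀ K, (c K)⁻¹ ≤ M := fun K =>
    Finset.single_le_sum (f := fun K => (c K)⁻¹) (fun K _ => (inv_pos.2 (hc K)).le)
      (Finset.mem_univ K)
  refine ⟨M, (inv_pos.2 (hc ∅)).trans_le (hMle ∅), ?_⟩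
  filter_upwards [hspan, hU, eventually_all.2 hcev] with z ⟨hzT, hzspan⟩ hzU hzc α β hα hact
  set v := ∑ i, α i • a i z + ∑ j, β j • b j z with hv
  let s : Finset ι := Finset.univ.filter fun i => α i ≠ 0
  obtain ⟨K, hKs, c', hc'0, hc'v, hli⟩ := exists_nonneg_repr_linearIndependent (fun i => a i z)
    hzT v s α (fun i _ => hα i) (by
      have : ∑ i ∈ s, α i • a i z = ∑ i, α i • a i z :=
        Finset.sum_filter_of_ne fun i _ h h0 => h (by rw [h0, zero_smul])
      rw [this, hv, add_sub_cancel_left]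
      exact sum_mem fun j _ => Submodule.smul_mem _ _ (hzspan j))
  -- Contrapositive of condition (iii): independence at `z` rules out positive-linear dependence at
  -- `z₀`.
  have hnP : ¬ PosLinDep (fun i : K => a i z₀) (fun j : T => b j z₀) := fun hP =>
    hK K (fun i hi => hact i (Finset.mem_filter.1 (hKs hi)).2) hP z hzU hli
  obtain ⟨d, hd⟩ := (Submodule.mem_span_range_iff_exists_fun ℝ).1 hc'v
  have hrep : ∑ i : K, c' i • a i z + ∑ j : T, d j • b j z = v := by
    rw [hd, Finset.sum_coe_sort K fun i => c' i • a i z, add_sub_cancel]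
  have hle := hzc K hnP (fun i => c' i) d (fun i => hc'0 i i.2)
  rw [hrep, ← le_div_iff₀' (hc K), div_eq_inv_mul] at hle
  have hle' : ‖((fun i : K => c' i), d)‖ ≤ M * ‖v‖ :=
    hle.trans (mul_le_mul_of_nonneg_right (hMle K) (norm_nonneg _))
  have hMv : 0 ≤ M * ‖v‖ := (norm_nonneg _).trans hle'
  refine ⟨fun i => if i ∈ K then c' i else 0, fun j => if h : j ∈ T then d ⟨j, h⟩ else 0,
    ?_, ?_, ?_, ?_, ?_⟩
  · intro i
    dsimp only
    split_ifs with h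
    exacts [hc'0 i h, le_rfl]
  · intro i hi
    exact if_neg fun h => (Finset.mem_filter.1 (hKs h)).2 hi
  · rw [← hrep, Finset.sum_coe_sort K fun i => c' i • a i z]
    congr 1
    · simp [ite_smul, Finset.sum_ite_mem]
    · rw [← Finset.sum_subset (Finset.subset_univ T)
        (fun j _ hj => by simp only [dif_neg hj, zero_smul]), ← Finset.sum_coe_sort]
      exact Finset.sum_congr rfl fun j _ => by simp
  · intro i
    dsimp only
    split_ifs with h
    · exact (le_abs_self _).trans
        (((norm_le_pi_norm (fun i : K => c' i) ⟨i, h⟩).trans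
          (norm_fst_le ((fun i : K => c' i), d))).trans hle')
    · exact hMv
  · intro j
    dsimp only
    split_ifs with h
    · exact ((norm_le_pi_norm d ⟨j, h⟩).trans
        (norm_snd_le ((fun i : K => c' i), d))).trans hle'
    · simpa using hMv

end Multipliers

/-! ### Approximate multipliers by quadratic penalization. -/

section Penalty

/-- Squaring smooths the kink of the positive part, because near 0 the function is O(s²). This makes
the inequality penalty differentiable. -/
theorem hasDerivAt_max_zero_sq (t : ℝ) :
    HasDerivAt (fun s : ℝ => max s 0 ^ 2) (2 * max t 0) t := by
  rcases lt_trichotomy t 0 with h | rfl | h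
  · rw [max_eq_right h.le, mul_zero]
    refine (hasDerivAt_const t (0 : ℝ)).congr_of_eventuallyEq ?_
    filter_upwards [Iio_mem_nhds h] with s hs
    simp [max_eq_right (le_of_lt (mem_Iio.1 hs))]
  · rw [max_self, mul_zero]
    refine HasDerivAt.of_isLittleO ?_
    have h1 : (fun s : ℝ => max s 0 ^ 2) =O[𝓝 0] fun s : ℝ => s ^ 2 := by
      refine Asymptotics.isBigO_of_le _ fun s => ?_
      rw [norm_pow, norm_pow]
      refine pow_le_pow_left₀ (norm_nonneg _) ?_ 2
      rcases le_total s 0 with h | h <;> simp [h]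
    have h2 : (fun s : ℝ => s ^ 2) =o[𝓝 0] fun s : ℝ => s := by
      simpa using Asymptotics.isLittleO_pow_id (𝕜 := ℝ) one_lt_two
    simpa using h1.trans_isLittleO h2
  · rw [max_eq_left h.le]
    have h1 : HasDerivAt (fun s : ℝ => s ^ 2) (2 * t) t := by simpa using hasDerivAt_pow 2 t
    refine h1.congr_of_eventuallyEq ?_
    filter_upwards [Ioi_mem_nhds h] with s hs
    simp [max_eq_left (le_of_lt (mem_Ioi.1 hs))]

variable {E ι κ : Type*} [NormedAddCommGroup E] [InnerProductSpace ℝ E] [FiniteDimensional ℝ E]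
  [Fintype ι] [Fintype κ]

/-- Approximate multipliers for a nearest point `w` of the set `{g ≤ 0, h = 0}` to `y`, obtained
by penalization. -/
theorem exists_approx_multipliers {g : ι → E → ℝ} {h : κ → E → ℝ} {a : ι → E → E} {b : κ → E → E}
    (hg : ∀ i z, HasGradientAt (g i) (a i z) z) (hh : ∀ j z, HasGradientAt (h j) (b j z) z)
    {w y : E} (hwg : ∀ i, g i w ≤ 0) (hwh : ∀ j, h j w = 0)
    (hmin : ∀ z, (∀ i, g i z ≤ 0) → (∀ j, h j z = 0) → ‖y - w‖ ≤ ‖y - z‖)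
    {ε : ℝ} (hε : 0 < ε) :
    ∃ (z : E) (α : ι → ℝ) (β : κ → ℝ), ‖z - w‖ < ε ∧ (∀ i, 0 ≤ α i) ∧
      (∀ i, α i ≠ 0 → 0 < g i z) ∧
      ∑ i, α i • a i z + ∑ j, β j • b j z = (y - w) - (2 : ℝ) • (z - w) := by
  have hgc : ∀ i, Continuous (g i) := fun i =>
    continuous_iff_continuousAt.2 fun z => (hg i z).continuousAt
  have hhc : ∀ j, Continuous (h j) := fun j =>
    continuous_iff_continuousAt.2 fun z => (hh j z).continuousAt
  let P : E → ℝ := fun z => ∑ i, max (g i z) 0 ^ 2 + ∑ j, h j z ^ 2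
  have hPc : Continuous P := by fun_prop
  have hP0 : ∀ z, 0 ≤ P z := fun z => by positivity
  have hPw : P w = 0 := by simp [P, hwg, hwh]
  -- The term ‖z - w‖² singles out `w` among the nearest points, so that minimizers can be localized
  -- near it.
  let F : ℕ → E → ℝ := fun k z => ‖z - y‖ ^ 2 + ‖z - w‖ ^ 2 + k * P z
  have hFc : ∀ k, Continuous (F k) := fun k => by fun_prop
  have hFw : ∀ k, F k w = ‖w - y‖ ^ 2 := fun k => by simp [F, hPw]
  have hFmono : ∀ k l, k ≤ l → ∀ z, F k z ≤ F l z := by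
    intro k l hkl z
    have : (k : ℝ) * P z ≤ l * P z :=
      mul_le_mul_of_nonneg_right (Nat.cast_le.2 hkl) (hP0 z)
    simp only [F]
    linarith
  -- On the sphere a feasible point loses by ε², an infeasible one by a large penalty. Compactness
  -- and monotonicity in `k` then give one `k` for the whole sphere, so the minimizer over the ball
  -- is interior.
  have hpt : ∀ z ∈ Metric.sphere w ε, ∃ k, F 0 w < F k z := by
    intro z hz
    have hzε : ‖z - w‖ = ε := by simpa [dist_eq_norm] using hz
    rcases (hP0 z).eq_or_lt with h0 | h0
    · refine ⟨0, ?_⟩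
      have hsum := (add_eq_zero_iff_of_nonneg
        (Finset.sum_nonneg fun i _ => sq_nonneg (max (g i z) 0))
        (Finset.sum_nonneg fun j _ => sq_nonneg (h j z))).1 h0.symm
      have h1 : ∀ i, g i z ≤ 0 := fun i => by
        have := (Finset.sum_eq_zero_iff_of_nonneg fun i _ => sq_nonneg (max (g i z) 0)).1 hsum.1 i
          (Finset.mem_univ i)
        simpa using this
      have h2 : ∀ j, h j z = 0 := fun j => by
        have := (Finset.sum_eq_zero_iff_of_nonneg fun j _ => sq_nonneg (h j z)).1 hsum.2 j
          (Finset.mem_univ j)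
        simpa using this
      have h3 : ‖w - y‖ ≤ ‖z - y‖ := by
        rw [norm_sub_rev w, norm_sub_rev z]
        exact hmin z h1 h2
      rw [hFw]
      simp only [F, hzε, CharP.cast_eq_zero, zero_mul, add_zero]
      have := pow_le_pow_left₀ (norm_nonneg _) h3 2
      nlinarith
    · obtain ⟨k, hk⟩ := exists_nat_gt (‖w - y‖ ^ 2 / P z)
      refine ⟨k, ?_⟩
      rw [div_lt_iff₀ h0] at hk
      rw [hFw]
      simp only [F]
      have := sq_nonneg ‖z - y‖
      have := sq_nonneg ‖z - w‖
      linarith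
  obtain ⟨k, hk⟩ := (isCompact_sphere w ε).elim_directed_cover
    (fun k => {z | F 0 w < F k z}) (fun k => isOpen_lt continuous_const (hFc k))
    (fun z hz => mem_iUnion.2 (hpt z hz))
    (directed_of_isDirected_le fun k l hkl z hz => lt_of_lt_of_le hz (hFmono k l hkl z))
  obtain ⟨z, hzB, hzmin⟩ := (isCompact_closedBall w ε).exists_isMinOn
    ⟨w, Metric.mem_closedBall_self hε.le⟩ (hFc k).continuousOn
  have hzlt : z ∈ Metric.ball w ε := by
    rw [← Metric.closedBall_sdiff_sphere]
    refine ⟨hzB, fun hzs => ?_⟩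
    have h1 : F 0 w < F k z := hk hzs
    have h2 : F k z ≤ F k w := hzmin (Metric.mem_closedBall_self hε.le)
    rw [hFw] at h1 h2
    exact absurd h1 h2.not_gt
  have hloc : IsLocalMin (F k) z :=
    hzmin.isLocalMin (mem_of_superset (Metric.isOpen_ball.mem_nhds hzlt)
      Metric.ball_subset_closedBall)
  have hdF := ((((hasFDerivAt_id z).sub_const y).norm_sq).add
    (((hasFDerivAt_id z).sub_const w).norm_sq)).add
    (((HasFDerivAt.fun_sum (u := Finset.univ) fun i _ =>
        (hasDerivAt_max_zero_sq (g i z)).comp_hasFDerivAt z (hg i z).hasFDerivAt).add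
      (HasFDerivAt.fun_sum (u := Finset.univ) fun j _ =>
        (hh j z).hasFDerivAt.pow 2)).const_mul (k : ℝ))
  have h0 := hloc.hasFDerivAt_eq_zero hdF
  refine ⟨z, fun i => k * max (g i z) 0, fun j => k * h j z, by
    simpa [dist_eq_norm] using hzlt, fun i => by positivity, fun i hi => ?_, ?_⟩
  · by_contra hcon
    exact hi (by simp [max_eq_right (not_lt.1 hcon)])
  -- Half of the equation ∇F_k(z) = 0, tested against an arbitrary vector.
  · rw [← sub_eq_zero]
    refine ext_inner_right ℝ fun u => ?_
    have h1 := congrArg (fun L : E →L[ℝ] ℝ => L u) h0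
    simp at h1
    simp only [inner_sub_left, inner_add_left, sum_inner, inner_smul_left, inner_zero_left,
      conj_trivial]
    simp only [mul_assoc, ← Finset.mul_sum] at h1 ⊢
    linarith

end Penalty

/-! ### Projection estimate and local error bound. -/

section GradientSystem

open scoped RealInnerProductSpace

variable {n m : ℕ} {ι κ : Type*}

/-- The maps `a`, `b` are the jointly continuous partial gradients of the constraint functions. -/
structure GradientSystem (g : ι → Euc n → Euc m → ℝ) (h : κ → Euc n → Euc m → ℝ)
    (a : ι → Euc n × Euc m → Euc m) (b : κ → Euc n × Euc m → Euc m) : Prop where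
  grad_ineq : ∀ i x y, HasGradientAt (g i x) (a i (x, y)) y
  grad_eq : ∀ j x y, HasGradientAt (h j x) (b j (x, y)) y
  cont_ineq : ∀ i, Continuous (a i)
  cont_eq : ∀ j, Continuous (b j)

variable {g : ι → Euc n → Euc m → ℝ} {h : κ → Euc n → Euc m → ℝ}
  {a : ι → Euc n × Euc m → Euc m} {b : κ → Euc n × Euc m → Euc m}

theorem GradientSystem.continuous_left (hS : GradientSystem g h a b) (i : ι) (x : Euc n) :
    Continuous (g i x) :=
  continuous_iff_continuousAt.2 fun y => (hS.grad_ineq i x y).continuousAt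

theorem GradientSystem.continuous_right (hS : GradientSystem g h a b) (j : κ) (x : Euc n) :
    Continuous (h j x) :=
  continuous_iff_continuousAt.2 fun y => (hS.grad_eq j x y).continuousAt

theorem GradientSystem.isClosed (hS : GradientSystem g h a b) (x : Euc n) :
    IsClosed (feasibleMap g h x) := by
  have : feasibleMap g h x = (⋂ i, {y | g i x y ≤ 0}) ∩ ⋂ j, {y | h j x y = 0} := by
    ext y
    simp [feasibleMap]
  rw [this]
  exact (isClosed_iInter fun i => isClosed_le (hS.continuous_left i x) continuous_const).inter
    (isClosed_iInter fun j => isClosed_eq (hS.continuous_right j x) continuous_const)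

theorem IsClosed.exists_norm_sub_le {C : Set (Euc m)} (hC : IsClosed C) (hne : C.Nonempty)
    (y : Euc m) : ∃ w ∈ C, ∀ v ∈ C, ‖y - w‖ ≤ ‖y - v‖ := by
  obtain ⟨w, hw, hwd⟩ := hC.exists_infDist_eq_dist hne y
  refine ⟨w, hw, fun v hv => ?_⟩
  rw [← dist_eq_norm, ← dist_eq_norm, ← hwd]
  exact Metric.infDist_le_dist_of_mem hv

/-- Uniform first-order expansion for a jointly continuous partial gradient. -/
theorem exists_uniform_first_order {φ : Euc n → Euc m → ℝ} {d : Euc n × Euc m → Euc m}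
    (hφ : ∀ x y, HasGradientAt (φ x) (d (x, y)) y) (hd : Continuous d) (x₀ : Euc n) (y₀ : Euc m)
    {η : ℝ} (hη : 0 < η) :
    ∃ δ : ℝ, 0 < δ ∧ ∀ x ∈ Metric.ball x₀ δ, ∀ y ∈ Metric.ball y₀ δ, ∀ v ∈ Metric.ball y₀ δ,
      |φ x y - φ x v - ⟪d (x, v), y - v⟫| ≤ η * ‖y - v‖ := by
  obtain ⟨δ, hδ, hball⟩ := Metric.continuousAt_iff.1 (hd.continuousAt (x := (x₀, y₀))) (η / 2)
    (half_pos hη)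
  have hmem : ∀ x ∈ Metric.ball x₀ δ, ∀ y ∈ Metric.ball y₀ δ, dist (d (x, y)) (d (x₀, y₀)) < η / 2 :=
    fun x hx y hy => hball (max_lt hx hy)
  refine ⟨δ, hδ, fun x hx y hy v hv => ?_⟩
  have := (convex_ball y₀ δ).norm_image_sub_le_of_norm_hasFDerivWithin_le' (f := φ x)
    (f' := fun u => InnerProductSpace.toDual ℝ (Euc m) (d (x, u)))
    (φ := InnerProductSpace.toDual ℝ (Euc m) (d (x, v))) (C := η)
    (fun u _ => (hφ x u).hasFDerivAt.hasFDerivWithinAt) (fun u hu => by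
      rw [← map_sub, LinearIsometryEquiv.norm_map, ← dist_eq_norm]
      have h1 := hmem x hx u hu
      have h2 := hmem x hx v hv
      have h3 := dist_triangle_right (d (x, u)) (d (x, v)) (d (x₀, y₀))
      linarith) hv hy
  simpa using this

variable [Fintype ι] [Fintype κ]

/-- Bound for the distance to a nearest feasible point, in terms of the constraint violation `r`
and the first-order error `η`. -/
theorem GradientSystem.exists_projection_bound (hS : GradientSystem g h a b)
    {x₀ : Euc n} {w₀ : Euc m} (hw₀ : w₀ ∈ feasibleMap g h x₀)
    (hgc : ∀ i, ContinuousAt (fun z : Euc n × Euc m => g i z.1 z.2) (x₀, w₀))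
    (hR : RelaxedConstPosLinDep {i | g i x₀ w₀ = 0} a b (x₀, w₀)) :
    ∃ M : ℝ, 0 < M ∧ ∀ᶠ z in 𝓝 (x₀, w₀), z.2 ∈ feasibleMap g h z.1 →
      ∀ y, (∀ v ∈ feasibleMap g h z.1, ‖y - z.2‖ ≤ ‖y - v‖) →
      ∀ r η : ℝ, 0 ≤ r → 0 ≤ η → (∀ i, g i z.1 y ≤ r) → (∀ j, |h j z.1 y| ≤ r) →
      (∀ᶠ v in 𝓝 z.2, ∀ i, ⟪a i (z.1, v), y - v⟫ ≤ g i z.1 y - g i z.1 v + η * ‖y - v‖) →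
      (∀ᶠ v in 𝓝 z.2, ∀ j,
        |h j z.1 y - h j z.1 v - ⟪b j (z.1, v), y - v⟫| ≤ η * ‖y - v‖) →
      ‖y - z.2‖ ≤ M * (r + η * ‖y - z.2‖) := by
  obtain ⟨M, hM, hev⟩ := hR.exists_bounded_coeff (fun i => (hS.cont_ineq i).continuousAt)
    (fun j => (hS.cont_eq j).continuousAt)
  -- Constraints violated near the base point are active there, so the penalty multipliers live on
  -- the active set.
  have hact : ∀ᶠ z : Euc n × Euc m in 𝓝 (x₀, w₀), ∀ i, 0 < g i z.1 z.2 → g i x₀ w₀ = 0 := by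
    refine eventually_all.2 fun i => ?_
    rcases (hw₀.1 i).lt_or_eq with hlt | heq
    · filter_upwards [(hgc i).eventually_lt_const hlt] with z hz hz'
      exact absurd hz' hz.not_gt
    · exact Eventually.of_forall fun _ _ => heq
  set N : ℝ := Fintype.card ι + Fintype.card κ with hN
  have hN0 : 0 ≤ N := by positivity
  refine ⟨N * M + 1, by positivity, ?_⟩
  -- The estimates are needed at the points (x, v) with v near w, where the approximate multipliers
  -- live, not only at (x, w).
  filter_upwards [(hev.and hact).eventually_nhds] with
    ⟨x, w⟩ hxw hw y hmin r η hr hη hgr hhr hgη hhη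
  dsimp only at hw hmin hgr hhr hgη hhη ⊢
  have hxw' : ∀ᶠ v in 𝓝 w, _ :=
    (Continuous.tendsto (f := fun v : Euc m => (x, v)) (by fun_prop) w).eventually hxw
  let V : Euc m → Euc m := fun v => (y - w) - (2 : ℝ) • (v - w)
  -- The sum of |h j x v| absorbs the infeasibility of v in the equalities and vanishes at v = w.
  -- Continuity of Φ carries `Φ v ≤ 0` over to `w`.
  let Φ : Euc m → ℝ := fun v => ⟪V v, y - v⟫ -
    N * (M * ‖V v‖ * (r + η * ‖y - v‖ + ∑ j, |h j x v|))
  have hΦc : Continuous Φ := by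
    have := fun j => hS.continuous_right j x
    fun_prop
  have hfreq : ∃ᶠ v in 𝓝 w, Φ v ≤ 0 := by
    refine Metric.nhds_basis_ball.frequently_iff.2 fun ε hε => ?_
    obtain ⟨δ, hδ, hδball⟩ := Metric.eventually_nhds_iff_ball.1 (hxw'.and (hgη.and hhη))
    obtain ⟨v, α, β, hvw, hα, hαpos, hsum⟩ := exists_approx_multipliers
      (fun i z => hS.grad_ineq i x z) (fun j z => hS.grad_eq j x z) hw.1 hw.2
      (fun z hz1 hz2 => hmin z ⟨hz1, hz2⟩) (lt_min hε hδ)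
    refine ⟨v, mem_ball_iff_norm.2 (hvw.trans_le (min_le_left _ _)), ?_⟩
    obtain ⟨⟨hco, hac⟩, hgv, hhv⟩ :=
      hδball v (mem_ball_iff_norm.2 (hvw.trans_le (min_le_right _ _)))
    obtain ⟨α', β', hα', hαα', hsum', hα'M, hβ'M⟩ :=
      hco α β hα fun i hi => hac i (hαpos i hi)
    rw [hsum] at hsum' hα'M hβ'M
    change ⟪V v, y - v⟫ - _ ≤ 0
    have hVM : 0 ≤ M * ‖V v‖ := by positivity
    have hs0 : ∀ j, |h j x v| ≤ ∑ j, |h j x v| := fun j =>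
      Finset.single_le_sum (f := fun j => |h j x v|) (fun _ _ => abs_nonneg _) (Finset.mem_univ j)
    have hs : 0 ≤ ∑ j, |h j x v| := Finset.sum_nonneg fun _ _ => abs_nonneg _
    have hην : 0 ≤ η * ‖y - v‖ := by positivity
    set B := M * ‖V v‖ * (r + η * ‖y - v‖ + ∑ j, |h j x v|) with hB
    have h1 : ∀ i, α' i * ⟪a i (x, v), y - v⟫ ≤ B := by
      intro i
      rcases (hα' i).eq_or_lt with h0 | h0
      · rw [← h0, zero_mul]
        positivity
      · have hne : α i ≠ 0 := fun hz => h0.ne' (hαα' i hz)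
        -- A nonzero weight means g i x v > 0, so the term -g i x v can be dropped.
        have h2 : ⟪a i (x, v), y - v⟫ ≤ r + η * ‖y - v‖ + ∑ j, |h j x v| := by
          linarith [hgv i, hgr i, hαpos i hne]
        exact (mul_le_mul_of_nonneg_left h2 h0.le).trans
          (mul_le_mul_of_nonneg_right (hα'M i) (by positivity))
    have h2 : ∀ j, β' j * ⟪b j (x, v), y - v⟫ ≤ B := by
      intro j
      have h3 : |⟪b j (x, v), y - v⟫| ≤ r + η * ‖y - v‖ + ∑ j, |h j x v| := by
        have e1 := abs_le.1 (hhv j)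
        have e2 := abs_le.1 (hhr j)
        have e3 := abs_le.1 (hs0 j)
        exact abs_le.2 ⟨by linarith, by linarith⟩
      refine (le_abs_self _).trans ?_
      rw [abs_mul]
      exact mul_le_mul (hβ'M j) h3 (abs_nonneg _) hVM
    have h3 : ⟪V v, y - v⟫ ≤ N * B := by
      have : V v = _ := hsum'.symm
      rw [this, inner_add_left, sum_inner, sum_inner, hN, add_mul]
      simp only [inner_smul_left, conj_trivial]
      refine add_le_add ((Finset.sum_le_sum fun i _ => h1 i).trans_eq ?_)
        ((Finset.sum_le_sum fun j _ => h2 j).trans_eq ?_) <;> simp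
    linarith
  have hΦw : Φ w ≤ 0 := by
    have hcl : IsClosed {v | Φ v ≤ 0} := isClosed_le hΦc continuous_const
    exact hcl.closure_subset (mem_closure_iff_frequently.2 hfreq)
  have hval : Φ w = ‖y - w‖ ^ 2 - N * (M * ‖y - w‖ * (r + η * ‖y - w‖)) := by
    simp [Φ, V, hw.2]
  rw [hval] at hΦw
  have hd := norm_nonneg (y - w)
  have hb : 0 ≤ r + η * ‖y - w‖ := by positivity
  rcases hd.eq_or_lt with h0 | h0
  · rw [← h0] at hb ⊢
    positivity
  · have : ‖y - w‖ ≤ N * M * (r + η * ‖y - w‖) := by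
      refine le_of_mul_le_mul_left ?_ h0
      linarith
    linarith

/-- Local error bound for an inner semicontinuous feasible set mapping. -/
theorem GradientSystem.exists_error_bound (hS : GradientSystem g h a b)
    {x₀ : Euc n} {y₀ : Euc m} (hy₀ : y₀ ∈ feasibleMap g h x₀)
    (hgc : ∀ i, ContinuousAt (fun z : Euc n × Euc m => g i z.1 z.2) (x₀, y₀))
    (hR : RelaxedConstPosLinDep {i | g i x₀ y₀ = 0} a b (x₀, y₀))
    (hisc : ∀ V ∈ 𝓝 y₀, ∀ᶠ x in 𝓝 x₀, (feasibleMap g h x ∩ V).Nonempty) :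
    ∃ c : ℝ, 0 < c ∧ ∀ᶠ z in 𝓝 (x₀, y₀), ∀ r : ℝ, 0 ≤ r →
      (∀ i, g i z.1 z.2 ≤ r) → (∀ j, |h j z.1 z.2| ≤ r) →
      ∃ w ∈ feasibleMap g h z.1, ‖z.2 - w‖ ≤ c * r := by
  obtain ⟨M, hM, hev⟩ := hS.exists_projection_bound hy₀ hgc hR
  -- With this η the error term is half of ‖y - w‖ and is absorbed on the left.
  have hη : 0 < 1 / (2 * M) := by positivity
  choose δ₁ hδ₁ hfo₁ using fun i =>
    exists_uniform_first_order (hS.grad_ineq i) (hS.cont_ineq i) x₀ y₀ hη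
  choose δ₂ hδ₂ hfo₂ using fun j =>
    exists_uniform_first_order (hS.grad_eq j) (hS.cont_eq j) x₀ y₀ hη
  obtain ⟨ε, hε, hεb⟩ := Metric.eventually_nhds_iff_ball.1 hev
  have hsmall : ∀ᶠ ρ : ℝ in 𝓝[>] 0, 0 < ρ ∧ (∀ i, ρ < δ₁ i) ∧ (∀ j, ρ < δ₂ j) ∧ ρ < ε := by
    filter_upwards [self_mem_nhdsWithin,
      eventually_all.2 fun i => nhdsWithin_le_nhds (Iio_mem_nhds (hδ₁ i)),
      eventually_all.2 fun j => nhdsWithin_le_nhds (Iio_mem_nhds (hδ₂ j)),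
      nhdsWithin_le_nhds (Iio_mem_nhds hε)] with ρ h1 h2 h3 h4 using ⟨h1, h2, h3, h4⟩
  obtain ⟨ρ, hρ, hρ₁, hρ₂, hρε⟩ := hsmall.exists
  have hρ4 : 0 < ρ / 4 := by positivity
  refine ⟨2 * M, by positivity, ?_⟩
  have hx : ∀ᶠ x in 𝓝 x₀, x ∈ Metric.ball x₀ ρ ∧
      (feasibleMap g h x ∩ Metric.ball y₀ (ρ / 4)).Nonempty :=
    Filter.Eventually.and (Metric.ball_mem_nhds x₀ hρ) (hisc _ (Metric.ball_mem_nhds y₀ hρ4))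
  rw [nhds_prod_eq]
  filter_upwards [hx.prod_mk (Metric.ball_mem_nhds y₀ hρ4)] with
    ⟨x, y⟩ ⟨⟨hxρ, p, hp, hpρ⟩, hyρ⟩ r hr hgr hhr
  dsimp only at hxρ hp hyρ hgr hhr ⊢
  obtain ⟨w, hw, hwmin⟩ := (hS.isClosed x).exists_norm_sub_le ⟨p, hp⟩ y
  -- The feasible point `p` near y₀ keeps the projection `w` inside the ball where the first-order
  -- expansions hold.
  have hyw : dist y w < ρ / 2 := by
    have h1 := hwmin p hp
    rw [← dist_eq_norm, ← dist_eq_norm] at h1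
    have h2 := dist_triangle_right y p y₀
    rw [Metric.mem_ball] at hpρ
    linarith
  have hwρ : w ∈ Metric.ball y₀ ρ := by
    rw [Metric.mem_ball]
    linarith [dist_triangle_left w y₀ y]
  have hyρ' : y ∈ Metric.ball y₀ ρ := Metric.ball_subset_ball (by linarith) hyρ
  have hnear : ∀ᶠ v in 𝓝 w, v ∈ Metric.ball y₀ ρ := Metric.isOpen_ball.mem_nhds hwρ
  have hsub : ∀ {X : Type} [PseudoMetricSpace X] {u c : X} {δ : ℝ}, ρ < δ →
      u ∈ Metric.ball c ρ → u ∈ Metric.ball c δ := fun hlt hu =>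
    Metric.ball_subset_ball hlt.le hu
  have hb := hεb (x, w) (by rw [← ball_prod_same]; exact ⟨hsub hρε hxρ, hsub hρε hwρ⟩)
    hw y hwmin r (1 / (2 * M)) hr hη.le hgr hhr
    (hnear.mono fun v hv i => by
      have := (abs_le.1 (hfo₁ i x (hsub (hρ₁ i) hxρ) y (hsub (hρ₁ i) hyρ') v (hsub (hρ₁ i) hv))).1
      linarith)
    (hnear.mono fun v hv j =>
      hfo₂ j x (hsub (hρ₂ j) hxρ) y (hsub (hρ₂ j) hyρ') v (hsub (hρ₂ j) hv))
  refine ⟨w, hw, ?_⟩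
  have h1 : M * (r + 1 / (2 * M) * ‖y - w‖) = M * r + ‖y - w‖ / 2 := by
    field_simp
  rw [h1] at hb
  linarith

end GradientSystem

/-! ### Inner semicontinuity in the convex case. -/

section Convex

open scoped RealInnerProductSpace

/-- Restriction to the line through v and y reduces this to the slope inequality in one variable. -/
theorem ConvexOn.inner_gradient_le {E : Type*} [NormedAddCommGroup E] [InnerProductSpace ℝ E]
    [CompleteSpace E] {φ : E → ℝ} (hφ : ConvexOn ℝ univ φ) {d v : E} (hd : HasGradientAt φ d v)
    (y : E) : ⟪d, y - v⟫ ≤ φ y - φ v := by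
  have h1 : ConvexOn ℝ univ (φ ∘ AffineMap.lineMap (k := ℝ) v y) := by
    simpa using hφ.comp_affineMap (AffineMap.lineMap (k := ℝ) v y)
  have h2 : HasDerivAt (φ ∘ AffineMap.lineMap (k := ℝ) v y) ⟪d, y - v⟫ 0 := by
    have h3 : HasFDerivAt φ (InnerProductSpace.toDual ℝ E d) (AffineMap.lineMap (k := ℝ) v y 0) := by
      simpa using hd.hasFDerivAt
    simpa using h3.comp_hasDerivAt (0 : ℝ) AffineMap.hasDerivAt_lineMap
  have h4 := h1.le_slope_of_hasDerivAt (mem_univ 0) (mem_univ 1) one_pos h2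
  simpa [slope] using h4

variable {n m : ℕ} {ι κ : Type*} [Fintype ι] [Fintype κ]
  {g : ι → Euc n → Euc m → ℝ} {h : κ → Euc n → Euc m → ℝ}
  {a : ι → Euc n × Euc m → Euc m} {b : κ → Euc n × Euc m → Euc m}

/-- For convex systems, the relaxed constant positive linear dependence condition at all feasible
points yields inner semicontinuity of a locally bounded feasible set mapping. -/
theorem GradientSystem.eventually_nonempty_inter_of_convex (hS : GradientSystem g h a b)
    (hconv : ∀ i x, ConvexOn ℝ univ (g i x))
    (haff : ∀ j x, ConvexOn ℝ univ (h j x) ∧ ConvexOn ℝ univ (-h j x))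
    {x₀ : Euc n} {B : Set (Euc m)} (hB : Bornology.IsBounded B)
    (hsub : ∀ᶠ x in 𝓝 x₀, feasibleMap g h x ⊆ B)
    (hne : ∀ᶠ x in 𝓝 x₀, (feasibleMap g h x).Nonempty)
    (hgc : ∀ i y, ContinuousAt (fun z : Euc n × Euc m => g i z.1 z.2) (x₀, y))
    (hhc : ∀ j y, ContinuousAt (fun z : Euc n × Euc m => h j z.1 z.2) (x₀, y))
    (hR : ∀ y ∈ feasibleMap g h x₀, RelaxedConstPosLinDep {i | g i x₀ y = 0} a b (x₀, y))
    {y₀ : Euc m} (hy₀ : y₀ ∈ feasibleMap g h x₀) :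
    ∀ V ∈ 𝓝 y₀, ∀ᶠ x in 𝓝 x₀, (feasibleMap g h x ∩ V).Nonempty := by
  intro V hV
  by_contra hcon
  obtain ⟨x, hx, hxp⟩ := exists_seq_forall_of_frequently
    ((not_eventually.1 hcon).and_eventually (hsub.and hne))
  choose w hw hwmin using fun k => (hS.isClosed (x k)).exists_norm_sub_le (hxp k).2.2 y₀
  -- The cluster point may a priori differ from y₀, which is why RCPLD is assumed at every feasible
  -- point.
  obtain ⟨w₀, -, σ, hσ, hlim⟩ := tendsto_subseq_of_bounded hB fun k => (hxp k).2.1 (hw k)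
  have hxσ : Tendsto (x ∘ σ) atTop (𝓝 x₀) := hx.comp hσ.tendsto_atTop
  have hz : Tendsto (fun k => (x (σ k), w (σ k))) atTop (𝓝 (x₀, w₀)) := hxσ.prodMk_nhds hlim
  have hz₀ : Tendsto (fun k => (x (σ k), y₀)) atTop (𝓝 (x₀, y₀)) :=
    hxσ.prodMk_nhds tendsto_const_nhds
  have hw₀ : w₀ ∈ feasibleMap g h x₀ :=
    ⟨fun i => le_of_tendsto ((hgc i w₀).tendsto.comp hz)
        (Eventually.of_forall fun k => (hw (σ k)).1 i),
      fun j => tendsto_nhds_unique ((hhc j w₀).tendsto.comp hz)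
        (tendsto_const_nhds.congr fun k => ((hw (σ k)).2 j).symm)⟩
  obtain ⟨M, hM, hev⟩ := hS.exists_projection_bound hw₀ (fun i => hgc i w₀) (hR w₀ hw₀)
  let r : ℕ → ℝ := fun k => ∑ i, max (g i (x (σ k)) y₀) 0 + ∑ j, |h j (x (σ k)) y₀|
  have hr : Tendsto r atTop (𝓝 0) := by
    have h1 : Tendsto r atTop (𝓝 (∑ i, max (g i x₀ y₀) 0 + ∑ j, |h j x₀ y₀|)) :=
      (tendsto_finsetSum _ fun i _ =>
        ((hgc i y₀).tendsto.comp hz₀).max tendsto_const_nhds).add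
      (tendsto_finsetSum _ fun j _ => ((hhc j y₀).tendsto.comp hz₀).abs)
    simpa [hy₀.1, hy₀.2] using h1
  have hbound : ∀ᶠ k in atTop, ‖y₀ - w (σ k)‖ ≤ M * r k := by
    filter_upwards [hz.eventually hev] with k hk
    have hg0 : 0 ≤ ∑ i, max (g i (x (σ k)) y₀) 0 :=
      Finset.sum_nonneg fun _ _ => le_max_right _ _
    have hh0 : 0 ≤ ∑ j, |h j (x (σ k)) y₀| := Finset.sum_nonneg fun _ _ => abs_nonneg _
    -- Here η = 0: the gradient inequality is global, so y₀ need not be close to w₀.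
    have := hk (hw (σ k)) y₀ (hwmin (σ k)) (r k) 0 (add_nonneg hg0 hh0) le_rfl
      (fun i => by
        have h1 := Finset.single_le_sum (f := fun i => max (g i (x (σ k)) y₀) 0)
          (fun _ _ => le_max_right _ _) (Finset.mem_univ i)
        have h2 := le_max_left (g i (x (σ k)) y₀) 0
        simp only [r]
        linarith)
      (fun j => by
        have h1 := Finset.single_le_sum (f := fun j => |h j (x (σ k)) y₀|)
          (fun _ _ => abs_nonneg _) (Finset.mem_univ j)
        simp only [r]
        linarith)
      (Eventually.of_forall fun v i => by
        simpa using (hconv i (x (σ k))).inner_gradient_le (hS.grad_ineq i (x (σ k)) v) y₀)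
      (Eventually.of_forall fun v j => by
        have h1 := (haff j (x (σ k))).1.inner_gradient_le (hS.grad_eq j (x (σ k)) v) y₀
        have hd : HasGradientAt (-h j (x (σ k))) (-b j (x (σ k), v)) v := by
          rw [hasGradientAt_iff_hasFDerivAt, map_neg]
          exact (hS.grad_eq j (x (σ k)) v).hasFDerivAt.neg
        have h2 := (haff j (x (σ k))).2.inner_gradient_le hd y₀
        simp only [Pi.neg_apply, inner_neg_left] at h2
        rw [zero_mul, abs_nonpos_iff]
        linarith)
    simpa using this
  have hto : Tendsto (fun k => w (σ k)) atTop (𝓝 y₀) := by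
    rw [tendsto_iff_norm_sub_tendsto_zero]
    refine squeeze_zero' (Eventually.of_forall fun _ => norm_nonneg _)
      (hbound.mono fun k hk => ?_) (by simpa using hr.const_mul M)
    rwa [norm_sub_rev]
  obtain ⟨k, hk⟩ := (hto.eventually hV).exists
  exact (hxp (σ k)).1 ⟨w (σ k), hw (σ k), hk⟩

end Convex

/-! ### From extended-real systems to real ones and back. -/

section Transfer

variable {n m : ℕ} {ι κ : Type*} {g : ι → Euc n → Euc m → ℝ} {h : κ → Euc n → Euc m → ℝ}
  {a : ι → Euc n × Euc m → Euc m} {b : κ → Euc n × Euc m → Euc m}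
  {g' : ι → Euc n → Euc m → EReal} {h' : κ → Euc n → Euc m → EReal} {x₀ : Euc n} {y₀ : Euc m}

theorem RCPLDAt.relaxedConstPosLinDep (H : RCPLDAt g' h' x₀ y₀) (hS : GradientSystem g h a b)
    (hg : ∀ᶠ x in 𝓝 x₀, ∀ i y, g' i x y = (g i x y : EReal))
    (hh : ∀ᶠ x in 𝓝 x₀, ∀ j y, h' j x y = (h j x y : EReal)) :
    RelaxedConstPosLinDep {i | g i x₀ y₀ = 0} a b (x₀, y₀) := by
  obtain ⟨U, hU, T, h1, ⟨r, h2⟩, h3⟩ := H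
  have hag : ∀ z : Euc n × Euc m, (∀ i y, g' i z.1 y = (g i z.1 y : EReal)) →
      ∀ i, gradY (g' i) z.1 z.2 = a i z := by
    intro z hz i
    simp only [gradY, hz, EReal.toReal_coe]
    exact (hS.grad_ineq i z.1 z.2).gradient
  have hbh : ∀ z : Euc n × Euc m, (∀ j y, h' j z.1 y = (h j z.1 y : EReal)) →
      ∀ j, gradY (h' j) z.1 z.2 = b j z := by
    intro z hz j
    simp only [gradY, hz, EReal.toReal_coe]
    exact (hS.grad_eq j z.1 z.2).gradient
  have hg₀ := hg.self_of_nhds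
  have hh₀ := hh.self_of_nhds
  have hfst : Tendsto Prod.fst (𝓝 (x₀, y₀)) (𝓝 x₀) := continuous_fst.tendsto (x₀, y₀)
  refine ⟨U ∩ {z | (∀ i y, g' i z.1 y = (g i z.1 y : EReal)) ∧
      ∀ j y, h' j z.1 y = (h j z.1 y : EReal)},
    inter_mem hU ((hfst.eventually hg).and (hfst.eventually hh)), T, ?_, ⟨r, ?_⟩, ?_⟩
  · simpa only [hbh (x₀, y₀) hh₀] using h1
  · rintro z ⟨hzU, -, hz⟩
    have := h2 z hzU
    rwa [show (fun j => gradY (h' j) z.1 z.2) = fun j => b j z from funext (hbh z hz)] at this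
  · rintro K hK hP z ⟨hzU, hz1, hz2⟩
    have := h3 K (fun i hi => by
      rw [hg₀ i y₀, (show g i x₀ y₀ = 0 from hK i hi), EReal.coe_zero]) (by
      simpa only [hag (x₀, y₀) hg₀, hbh (x₀, y₀) hh₀] using hP) z hzU
    simpa only [hag z hz1, hbh z hz2] using this

/-- Discarding inequalities only leaves fewer sets `K` to test. It is used to drop h₀ and pass from
S to Γ. -/
theorem RelaxedConstPosLinDep.comp_embedding {Z V ι' : Type*} [TopologicalSpace Z]
    [NormedAddCommGroup V] [NormedSpace ℝ V] {act : Set ι} {a : ι → Z → V} {b : κ → Z → V} {z₀ : Z}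
    (H : RelaxedConstPosLinDep act a b z₀) (e : ι' ↪ ι) :
    RelaxedConstPosLinDep (e ⁻¹' act) (fun i => a (e i)) b z₀ := by
  classical
  obtain ⟨U, hU, T, h1, h2, h3⟩ := H
  refine ⟨U, hU, T, h1, h2, fun K hK hP z hz hli => ?_⟩
  let E : K ≃ K.map e := Equiv.ofBijective (fun i => ⟨e i, Finset.mem_map_of_mem e i.2⟩)
    ⟨fun i j hij => Subtype.ext (e.injective (congrArg Subtype.val hij)), fun ⟨i, hi⟩ => by
      obtain ⟨k, hk, rfl⟩ := Finset.mem_map.1 hi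
      exact ⟨⟨k, hk⟩, rfl⟩⟩
  refine h3 (K.map e) (fun i hi => ?_) ?_ z hz ?_
  · obtain ⟨k, hk, rfl⟩ := Finset.mem_map.1 hi
    exact hK k hk
  · obtain ⟨α, β, hα, hne, hsum⟩ := hP
    refine ⟨α ∘ E.symm, β, fun i => hα _, hne.imp_left fun ⟨i, hi⟩ => ⟨E i, by simpa using hi⟩, ?_⟩
    rw [← hsum]
    congr 1
    exact (Fintype.sum_equiv E _ _ fun i => by
      rw [Function.comp_apply, E.symm_apply_apply]; rfl).symm
  · refine (linearIndependent_equiv' (Equiv.sumCongr E (Equiv.refl T)) ?_).1 hli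
    funext i
    rcases i with i | i <;> rfl

/-- Passage from a local error bound for a real system to R-regularity. -/
theorem rRegularAt_of_error_bound {Υ : Euc n → Set (Euc m)}
    (hg : ∀ᶠ x in 𝓝 x₀, ∀ i y, g' i x y = (g i x y : EReal))
    (hh : ∀ᶠ x in 𝓝 x₀, ∀ j y, h' j x y = (h j x y : EReal))
    (hΥ : ∀ᶠ x in 𝓝 x₀, Υ x = feasibleMap g h x)
    (H : ∃ c : ℝ, 0 < c ∧ ∀ᶠ z in 𝓝 (x₀, y₀), ∀ r : ℝ, 0 ≤ r →
      (∀ i, g i z.1 z.2 ≤ r) → (∀ j, |h j z.1 z.2| ≤ r) →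
      ∃ w ∈ feasibleMap g h z.1, ‖z.2 - w‖ ≤ c * r) :
    RRegularAt Υ g' h' x₀ y₀ := by
  obtain ⟨c, hc, hev⟩ := H
  have hfst : Tendsto Prod.fst (𝓝 (x₀, y₀)) (𝓝 x₀) := continuous_fst.tendsto (x₀, y₀)
  refine ⟨c, hc, _, hev.and ((hfst.eventually hg).and ((hfst.eventually hh).and
    (hfst.eventually hΥ))), ?_⟩
  rintro z ⟨hz, hgz, hhz, hΥz⟩
  rcases eq_or_ne (constraintResidual g' h' z.1 z.2) ⊤ with htop | htop
  · rw [htop, ENNReal.mul_top (by simpa using hc)]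
    exact le_top
  obtain ⟨w, hw, hwd⟩ := hz (constraintResidual g' h' z.1 z.2).toReal ENNReal.toReal_nonneg
    (fun i => by
      rw [← ENNReal.ofReal_le_iff_le_toReal htop, ← EReal.real_coe_toENNReal, ← hgz]
      exact (le_iSup (fun i => (g' i z.1 z.2).toENNReal) i).trans (le_max_left _ _))
    (fun j => by
      rw [← ENNReal.ofReal_le_iff_le_toReal htop, ← EReal.abs_def, ← hhz]
      exact (le_iSup (fun j => (h' j z.1 z.2).abs) j).trans (le_max_right _ _))
  have hwΥ : w ∈ Υ z.1 := by rwa [hΥz]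
  refine (Metric.infEDist_le_edist_of_mem hwΥ).trans ?_
  rw [edist_dist, dist_eq_norm]
  refine (ENNReal.ofReal_le_ofReal hwd).trans_eq ?_
  rw [ENNReal.ofReal_mul hc.le, ENNReal.ofReal_toReal htop]

end Transfer

/-! ### Error bounds and the Aubin property. -/

section Lipschitz

variable {n m : ℕ} {ι κ : Type*} {x₀ : Euc n} {y₀ : Euc m}

/-- Local Lipschitz continuity in the parameter, uniformly in the second variable. -/
def LipschitzInParameter (φ : Euc n → Euc m → ℝ) (x₀ : Euc n) (y₀ : Euc m) : Prop :=
  ∃ L : ℝ, 0 ≤ L ∧ ∀ᶠ p : Euc n × Euc n × Euc m in 𝓝 (x₀, x₀, y₀),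
    |φ p.1 p.2.2 - φ p.2.1 p.2.2| ≤ L * ‖p.1 - p.2.1‖

theorem ContDiff.lipschitzInParameter {φ : Euc n → Euc m → ℝ}
    (hφ : ContDiff ℝ 1 fun z : Euc n × Euc m => φ z.1 z.2) (x₀ : Euc n) (y₀ : Euc m) :
    LipschitzInParameter φ x₀ y₀ := by
  obtain ⟨K, t, ht, hK⟩ := (hφ.contDiffAt (x := (x₀, y₀))).exists_lipschitzOnWith
  have h1 : Tendsto (fun p : Euc n × Euc n × Euc m => (p.1, p.2.2)) (𝓝 (x₀, x₀, y₀))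
      (𝓝 (x₀, y₀)) := Continuous.tendsto (by fun_prop) (x₀, x₀, y₀)
  have h2 : Tendsto (fun p : Euc n × Euc n × Euc m => (p.2.1, p.2.2)) (𝓝 (x₀, x₀, y₀))
      (𝓝 (x₀, y₀)) := Continuous.tendsto (by fun_prop) (x₀, x₀, y₀)
  refine ⟨K, K.2, ?_⟩
  filter_upwards [h1 ht, h2 ht] with p hp1 hp2
  have := hK.dist_le_mul (p.1, p.2.2) hp1 (p.2.1, p.2.2) hp2
  rwa [Prod.dist_eq, dist_self, max_eq_left dist_nonneg, Real.dist_eq, dist_eq_norm] at this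

variable {g : ι → Euc n → Euc m → ℝ} {h : κ → Euc n → Euc m → ℝ} [Fintype ι] [Fintype κ]

/-- A local error bound and Lipschitz dependence on the parameter give the Aubin property. -/
theorem exists_aubin_of_error_bound
    (H : ∃ c : ℝ, 0 < c ∧ ∀ᶠ z in 𝓝 (x₀, y₀), ∀ r : ℝ, 0 ≤ r →
      (∀ i, g i z.1 z.2 ≤ r) → (∀ j, |h j z.1 z.2| ≤ r) →
      ∃ w ∈ feasibleMap g h z.1, ‖z.2 - w‖ ≤ c * r)
    (hg : ∀ i, LipschitzInParameter (g i) x₀ y₀) (hh : ∀ j, LipschitzInParameter (h j) x₀ y₀) :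
    ∃ c : ℝ, 0 < c ∧ ∀ᶠ p : Euc n × Euc n × Euc m in 𝓝 (x₀, x₀, y₀),
      p.2.2 ∈ feasibleMap g h p.1 →
        ∃ w ∈ feasibleMap g h p.2.1, ‖p.2.2 - w‖ ≤ c * ‖p.1 - p.2.1‖ := by
  obtain ⟨c, hc, hev⟩ := H
  choose A hA hgev using hg
  choose B hB hhev using hh
  have h2 : Tendsto (fun p : Euc n × Euc n × Euc m => (p.2.1, p.2.2)) (𝓝 (x₀, x₀, y₀))
      (𝓝 (x₀, y₀)) := Continuous.tendsto (by fun_prop) (x₀, x₀, y₀)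
  have hA' : 0 ≤ ∑ i, A i := Finset.sum_nonneg fun i _ => hA i
  have hB' : 0 ≤ ∑ j, B j := Finset.sum_nonneg fun j _ => hB j
  refine ⟨c * (∑ i, A i + ∑ j, B j + 1), by positivity, ?_⟩
  filter_upwards [eventually_all.2 hgev, eventually_all.2 hhev, h2.eventually hev]
    with ⟨x, x', y⟩ h3 h4 h5 hy
  dsimp only at h3 h4 h5 hy ⊢
  have hn := norm_nonneg (x - x')
  -- Since y is feasible for x, its violation at x' is at most the Lipschitz variation of the
  -- constraints.
  obtain ⟨w, hw, hwd⟩ := h5 ((∑ i, A i + ∑ j, B j + 1) * ‖x - x'‖) (by positivity)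
    (fun i => by
      have e1 := (abs_le.1 (h3 i)).1
      have e2 := hy.1 i
      have e3 : A i ≤ ∑ i, A i := Finset.single_le_sum (fun i _ => hA i) (Finset.mem_univ i)
      have e4 : A i * ‖x - x'‖ ≤ (∑ i, A i + ∑ j, B j + 1) * ‖x - x'‖ :=
        mul_le_mul_of_nonneg_right (by linarith) hn
      linarith)
    (fun j => by
      have e1 := h4 j
      rw [hy.2 j, zero_sub, abs_neg] at e1
      have e3 : B j ≤ ∑ j, B j := Finset.single_le_sum (fun j _ => hB j) (Finset.mem_univ j)
      exact e1.trans (mul_le_mul_of_nonneg_right (by linarith) hn))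
  exact ⟨w, hw, by rwa [mul_assoc]⟩

theorem aubinAt_of_eventually {Υ Υ' : Euc n → Set (Euc m)} (hΥ : ∀ᶠ x in 𝓝 x₀, Υ x = Υ' x)
    (H : ∃ c : ℝ, 0 < c ∧ ∀ᶠ p : Euc n × Euc n × Euc m in 𝓝 (x₀, x₀, y₀),
      p.2.2 ∈ Υ' p.1 → ∃ w ∈ Υ' p.2.1, ‖p.2.2 - w‖ ≤ c * ‖p.1 - p.2.1‖) :
    AubinAt Υ x₀ y₀ := by
  obtain ⟨c, hc, hev⟩ := H
  rw [nhds_prod_eq, nhds_prod_eq] at hev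
  obtain ⟨U, hU, Q, hQ, hUQ⟩ := mem_prod_iff.1 hev
  obtain ⟨U', hU', V, hV, hQ'⟩ := mem_prod_iff.1 hQ
  refine ⟨U ∩ U' ∩ {x | Υ x = Υ' x}, inter_mem (inter_mem hU hU') hΥ, V, hV, c, hc, ?_⟩
  rintro x ⟨⟨hx, -⟩, hxΥ⟩ x' ⟨⟨-, hx'⟩, hx'Υ⟩ y ⟨hy, hyV⟩
  obtain ⟨w, hw, hwd⟩ := hUQ (mk_mem_prod hx (hQ' (mk_mem_prod hx' hyV)))
    (show y ∈ Υ' x by rw [← show Υ x = Υ' x from hxΥ]; exact hy)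
  refine mem_add.2 ⟨w, ?_, y - w, by simpa using hwd, add_sub_cancel _ _⟩
  rw [show Υ x' = Υ' x' from hx'Υ]
  exact hw

theorem InnerSemicontinuousAt.eventually_nonempty_inter {Υ : Euc n → Set (Euc m)}
    (H : InnerSemicontinuousAt Υ x₀ y₀) :
    ∀ V ∈ 𝓝 y₀, ∀ᶠ x in 𝓝 x₀, (Υ x ∩ V).Nonempty := by
  intro V hV
  by_contra hcon
  obtain ⟨x, hx, hxV⟩ := exists_seq_forall_of_frequently (not_eventually.1 hcon)
  obtain ⟨y, hy, hyΥ⟩ := H x hx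
  obtain ⟨k, hk1, hk2⟩ := (hyΥ.and (hy.eventually hV)).exists
  exact hxV k ⟨y k, hk1, hk2⟩

end Lipschitz

/-! ### The optimal value function and the real description of S. -/

section OptimalValue

variable {n m : ℕ} {ι κ : Type*} {f : Euc n → Euc m → ℝ} {g : ι → Euc n → Euc m → ℝ}
  {h : κ → Euc n → Euc m → ℝ}

theorem optimalValue_eq_of_mem_solutionMap {x : Euc n} {y : Euc m} (hy : y ∈ solutionMap f g h x) :
    optimalValue f g h x = (f x y : EReal) :=
  le_antisymm (iInf₂_le y hy.1) (le_iInf₂ fun z hz => EReal.coe_le_coe_iff.2 (hy.2 z hz))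

theorem optimalValue_le_of_mem_feasibleMap {x : Euc n} {y : Euc m} (hy : y ∈ feasibleMap g h x) :
    optimalValue f g h x ≤ (f x y : EReal) :=
  iInf₂_le y hy

/-- The real-valued inequality constraints `f - φ ≤ 0`, `g i ≤ 0`. -/
def realSolIneq (f : Euc n → Euc m → ℝ) (φ : Euc n → ℝ) (g : ι → Euc n → Euc m → ℝ) :
    Option ι → Euc n → Euc m → ℝ
  | none => fun x y => f x y - φ x
  | some i => g i

theorem solIneq_eq_coe {φ : Euc n → ℝ} {x : Euc n} (hx : optimalValue f g h x = (φ x : EReal))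
    (i : Option ι) (y : Euc m) : solIneq f g h i x y = (realSolIneq f φ g i x y : EReal) := by
  rcases i with _ | i
  · simp only [solIneq, realSolIneq, hx, EReal.coe_sub]
  · rfl

theorem solutionMap_eq_feasibleMap {φ : Euc n → ℝ} {x : Euc n}
    (hx : optimalValue f g h x = (φ x : EReal)) :
    solutionMap f g h x = feasibleMap (realSolIneq f φ g) h x := by
  ext y
  rw [mem_solutionMap_iff]
  simp only [solIneq_eq_coe hx, solEq, EReal.coe_nonpos, EReal.coe_eq_zero]
  rfl

/-- The partial gradient of a real-valued function. -/
noncomputable def partialGradient (φ : Euc n → Euc m → ℝ) (z : Euc n × Euc m) : Euc m :=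
  gradient (φ z.1) z.2

theorem ContDiff.hasFDerivAt_right {φ : Euc n → Euc m → ℝ}
    (hφ : ContDiff ℝ 1 fun z : Euc n × Euc m => φ z.1 z.2) (x : Euc n) (y : Euc m) :
    HasFDerivAt (φ x) ((fderiv ℝ (fun z : Euc n × Euc m => φ z.1 z.2) (x, y)).comp
      (ContinuousLinearMap.inr ℝ (Euc n) (Euc m))) y :=
  HasFDerivAt.comp (g := fun z : Euc n × Euc m => φ z.1 z.2) y
    ((hφ.differentiable one_ne_zero) (x, y)).hasFDerivAt (hasFDerivAt_prodMk_right x y)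

theorem ContDiff.hasGradientAt_right {φ : Euc n → Euc m → ℝ}
    (hφ : ContDiff ℝ 1 fun z : Euc n × Euc m => φ z.1 z.2) (x : Euc n) (y : Euc m) :
    HasGradientAt (φ x) (partialGradient φ (x, y)) y :=
  (hφ.hasFDerivAt_right x y).differentiableAt.hasGradientAt

theorem ContDiff.continuous_partialGradient {φ : Euc n → Euc m → ℝ}
    (hφ : ContDiff ℝ 1 fun z : Euc n × Euc m => φ z.1 z.2) : Continuous (partialGradient φ) := by
  have h1 : partialGradient φ = fun z => (InnerProductSpace.toDual ℝ (Euc m)).symm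
      ((fderiv ℝ (fun z : Euc n × Euc m => φ z.1 z.2) z).comp
        (ContinuousLinearMap.inr ℝ (Euc n) (Euc m))) := by
    funext z
    rw [partialGradient, gradient, (hφ.hasFDerivAt_right z.1 z.2).fderiv]
  rw [h1]
  exact (InnerProductSpace.toDual ℝ (Euc m)).symm.continuous.comp
    ((hφ.continuous_fderiv one_ne_zero).clm_comp continuous_const)

theorem gradientSystem_of_contDiff
    (hg : ∀ i, ContDiff ℝ 1 (fun z : Euc n × Euc m => g i z.1 z.2))
    (hh : ∀ j, ContDiff ℝ 1 (fun z : Euc n × Euc m => h j z.1 z.2)) :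
    GradientSystem g h (fun i => partialGradient (g i)) (fun j => partialGradient (h j)) where
  grad_ineq i := (hg i).hasGradientAt_right
  grad_eq j := (hh j).hasGradientAt_right
  cont_ineq i := (hg i).continuous_partialGradient
  cont_eq j := (hh j).continuous_partialGradient

/-- The partial gradients of `f - φ` and the `g i`. -/
noncomputable def solGradient (f : Euc n → Euc m → ℝ) (g : ι → Euc n → Euc m → ℝ) :
    Option ι → Euc n × Euc m → Euc m
  | none => partialGradient f
  | some i => partialGradient (g i)

/-- No regularity of φ is required: it is constant in y and disappears from the partial gradient. -/
theorem gradientSystem_realSolIneq (φ : Euc n → ℝ)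
    (hf : ContDiff ℝ 1 (fun z : Euc n × Euc m => f z.1 z.2))
    (hg : ∀ i, ContDiff ℝ 1 (fun z : Euc n × Euc m => g i z.1 z.2))
    (hh : ∀ j, ContDiff ℝ 1 (fun z : Euc n × Euc m => h j z.1 z.2)) :
    GradientSystem (realSolIneq f φ g) h (solGradient f g) (fun j => partialGradient (h j)) where
  grad_ineq
    | none => fun x y => by
      rw [hasGradientAt_iff_hasFDerivAt]
      exact (hf.hasGradientAt_right x y).hasFDerivAt.sub_const (φ x)
    | some i => (hg i).hasGradientAt_right
  grad_eq j := (hh j).hasGradientAt_right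
  cont_ineq
    | none => hf.continuous_partialGradient
    | some i => (hg i).continuous_partialGradient
  cont_eq j := (hh j).continuous_partialGradient

theorem continuousAt_realSolIneq {φ : Euc n → ℝ} {x₀ : Euc n} (hφ : ContinuousAt φ x₀)
    (hf : ContDiff ℝ 1 (fun z : Euc n × Euc m => f z.1 z.2))
    (hg : ∀ i, ContDiff ℝ 1 (fun z : Euc n × Euc m => g i z.1 z.2)) (i : Option ι) (y : Euc m) :
    ContinuousAt (fun z : Euc n × Euc m => realSolIneq f φ g i z.1 z.2) (x₀, y) := by
  rcases i with _ | i
  · exact hf.continuous.continuousAt.sub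
      (ContinuousAt.comp (f := Prod.fst) (x := (x₀, y)) hφ continuousAt_fst)
  · exact (hg i).continuous.continuousAt

/-- Lipschitz continuity of the optimal value function. -/
theorem exists_abs_optimalValue_sub_le {φ : Euc n → ℝ} {x₀ : Euc n} {y₀ : Euc m}
    (hf : ContDiff ℝ 1 (fun z : Euc n × Euc m => f z.1 z.2))
    (hφ : ∀ᶠ x in 𝓝 x₀, optimalValue f g h x = (φ x : EReal))
    (hisc : ∀ V ∈ 𝓝 y₀, ∀ᶠ x in 𝓝 x₀, (solutionMap f g h x ∩ V).Nonempty)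
    (H : ∃ c : ℝ, 0 < c ∧ ∀ᶠ p : Euc n × Euc n × Euc m in 𝓝 (x₀, x₀, y₀),
      p.2.2 ∈ feasibleMap g h p.1 →
        ∃ w ∈ feasibleMap g h p.2.1, ‖p.2.2 - w‖ ≤ c * ‖p.1 - p.2.1‖) :
    ∃ L : ℝ, 0 ≤ L ∧ ∀ᶠ p : Euc n × Euc n in 𝓝 (x₀, x₀), |φ p.1 - φ p.2| ≤ L * ‖p.1 - p.2‖ := by
  obtain ⟨c, hc, hev⟩ := H
  obtain ⟨K, t, ht, hK⟩ := (hf.contDiffAt (x := (x₀, y₀))).exists_lipschitzOnWith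
  obtain ⟨ε, hε, hεt⟩ := Metric.mem_nhds_iff.1 ht
  obtain ⟨ρ, hρ, hρev⟩ := Metric.eventually_nhds_iff_ball.1 hev
  -- Since ‖x - x'‖ ≤ 2σ, the moved point w stays within 2cσ + σ ≤ ε of y₀, inside the Lipschitz
  -- region of f.
  obtain ⟨σ, hσ, hσρ, hσε⟩ : ∃ σ : ℝ, 0 < σ ∧ σ ≤ ρ ∧ (2 * c + 1) * σ ≤ ε :=
    ⟨min ρ (ε / (2 * c + 1)), by positivity, min_le_left _ _, by
      rw [← le_div_iff₀' (by positivity)]; exact min_le_right _ _⟩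
  have hσε' : σ ≤ ε := by nlinarith
  -- One-sided estimate φ(x') ≤ f(x', w) ≤ f(x, y) + K(1 + c)‖x - x'‖ with y ∈ S(x); exchanging x
  -- and x' gives the other side.
  have key : ∀ᶠ p : Euc n × Euc n in 𝓝 (x₀, x₀),
      φ p.2 - φ p.1 ≤ K * (1 + c) * ‖p.1 - p.2‖ := by
    have hx : ∀ᶠ x in 𝓝 x₀, x ∈ Metric.ball x₀ σ ∧ optimalValue f g h x = (φ x : EReal) ∧
        (solutionMap f g h x ∩ Metric.ball y₀ σ).Nonempty :=
      Filter.Eventually.and (Metric.ball_mem_nhds x₀ hσ)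
        (hφ.and (hisc _ (Metric.ball_mem_nhds y₀ hσ)))
    rw [nhds_prod_eq]
    filter_upwards [hx.prod_mk hx] with ⟨x, x'⟩ ⟨⟨hxσ, hxφ, y, hyS, hyσ⟩, hx'σ, hx'φ, _⟩
    dsimp only at hxσ hxφ hyS hx'σ hx'φ ⊢
    obtain ⟨w, hw, hwd⟩ := hρev (x, x', y) (by
      rw [← ball_prod_same, ← ball_prod_same]
      exact ⟨Metric.ball_subset_ball hσρ hxσ, Metric.ball_subset_ball hσρ hx'σ,
        Metric.ball_subset_ball hσρ hyσ⟩) hyS.1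
    dsimp only at hw hwd
    have hxx' : ‖x - x'‖ ≤ 2 * σ := by
      rw [← dist_eq_norm]
      rw [Metric.mem_ball] at hxσ hx'σ
      linarith [dist_triangle_right x x' x₀]
    have hwε : w ∈ Metric.ball y₀ ε := by
      have h1 := dist_triangle_left w y₀ y
      rw [dist_eq_norm y w] at h1
      rw [Metric.mem_ball] at hyσ ⊢
      nlinarith
    have h1 := hK.dist_le_mul (x', w) (hεt (by
      rw [← ball_prod_same]
      exact ⟨Metric.ball_subset_ball hσε' hx'σ, hwε⟩)) (x, y) (hεt (by
      rw [← ball_prod_same]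
      exact ⟨Metric.ball_subset_ball hσε' hxσ, Metric.ball_subset_ball hσε' hyσ⟩))
    have h2 : dist (x', w) (x, y) ≤ (1 + c) * ‖x - x'‖ := by
      rw [Prod.dist_eq, dist_comm x', dist_comm w, dist_eq_norm, dist_eq_norm]
      have := norm_nonneg (x - x')
      exact max_le (by nlinarith) (by linarith)
    have h3 : φ x = f x y :=
      EReal.coe_injective (hxφ.symm.trans (optimalValue_eq_of_mem_solutionMap hyS))
    have h4 : φ x' ≤ f x' w := by
      rw [← EReal.coe_le_coe_iff, ← hx'φ]
      exact optimalValue_le_of_mem_feasibleMap hw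
    have h5 := (le_abs_self _).trans h1
    have h6 := mul_le_mul_of_nonneg_left h2 K.2
    change f x' w - f x y ≤ _ at h5
    change (K : ℝ) * _ ≤ K * _ at h6
    linarith
  refine ⟨K * (1 + c), by positivity, ?_⟩
  have hswap : Tendsto Prod.swap (𝓝 (x₀, x₀)) (𝓝 (x₀, x₀)) := continuous_swap.tendsto (x₀, x₀)
  filter_upwards [key, hswap.eventually key] with p h1 h2
  rw [Prod.fst_swap, Prod.snd_swap, norm_sub_rev] at h2
  exact abs_le.2 ⟨by linarith, h2⟩

end OptimalValue

/-! ### Regularity of the solution mapping. -/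

section ParametricOptimization

variable {n m : ℕ} {ι κ : Type*} [Fintype ι] [Fintype κ] {f : Euc n → Euc m → ℝ}
  {g : ι → Euc n → Euc m → ℝ} {h : κ → Euc n → Euc m → ℝ} {x₀ : Euc n} {y₀ : Euc m}

theorem rRegularAt_and_aubinAt_of_innerSemicontinuous
    (hf : ContDiff ℝ 1 (fun z : Euc n × Euc m => f z.1 z.2))
    (hg : ∀ i, ContDiff ℝ 1 (fun z : Euc n × Euc m => g i z.1 z.2))
    (hh : ∀ j, ContDiff ℝ 1 (fun z : Euc n × Euc m => h j z.1 z.2))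
    (hy₀ : y₀ ∈ solutionMap f g h x₀)
    (hisc : ∀ V ∈ 𝓝 y₀, ∀ᶠ x in 𝓝 x₀, (solutionMap f g h x ∩ V).Nonempty)
    (hR : RCPLDAt (solIneq f g h) (solEq h) x₀ y₀) :
    RRegularAt (solutionMap f g h) (solIneq f g h) (solEq h) x₀ y₀ ∧
      AubinAt (solutionMap f g h) x₀ y₀ := by
  set φ : Euc n → ℝ := fun x => (optimalValue f g h x).toReal with hφdef
  have hφS : ∀ x y, y ∈ solutionMap f g h x → φ x = f x y := fun x y hy => by
    simp only [hφdef, optimalValue_eq_of_mem_solutionMap hy, EReal.toReal_coe]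
  have hφ : ∀ᶠ x in 𝓝 x₀, optimalValue f g h x = (φ x : EReal) := by
    filter_upwards [hisc univ univ_mem] with x ⟨y, hy, _⟩
    rw [hφS x y hy, optimalValue_eq_of_mem_solutionMap hy]
  -- Minimizers near y₀ exist for x near x₀, and φ(x) is the value of f at them, hence close to
  -- f(x₀, y₀).
  have hφc : ContinuousAt φ x₀ := by
    rw [ContinuousAt, hφS x₀ y₀ hy₀, Metric.tendsto_nhds]
    intro ε hε
    have hfc := Metric.tendsto_nhds.1 (hf.continuous.tendsto (x₀, y₀)) ε hε
    rw [nhds_prod_eq] at hfc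
    obtain ⟨U, hU, V, hV, hUV⟩ := mem_prod_iff.1 hfc
    filter_upwards [hU, hisc V hV] with x hxU ⟨y, hyS, hyV⟩
    rw [hφS x y hyS]
    exact hUV (mk_mem_prod hxU hyV)
  have hSsys := gradientSystem_realSolIneq φ hf hg hh
  have hsolg : ∀ᶠ x in 𝓝 x₀, ∀ i y, solIneq f g h i x y = (realSolIneq f φ g i x y : EReal) :=
    hφ.mono fun x hx i y => solIneq_eq_coe hx i y
  have hsolh : ∀ᶠ x in 𝓝 x₀, ∀ j y, solEq h j x y = (h j x y : EReal) :=
    Eventually.of_forall fun _ _ _ => rfl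
  have hSmap : ∀ᶠ x in 𝓝 x₀, solutionMap f g h x = feasibleMap (realSolIneq f φ g) h x :=
    hφ.mono fun x hx => solutionMap_eq_feasibleMap hx
  have hRS := hR.relaxedConstPosLinDep hSsys hsolg hsolh
  have hEB := hSsys.exists_error_bound (hSmap.self_of_nhds ▸ hy₀)
    (fun i => continuousAt_realSolIneq hφc hf hg i y₀) hRS
    (fun V hV => by
      filter_upwards [hSmap, hisc V hV] with x hx hxV
      rwa [← hx])
  refine ⟨rRegularAt_of_error_bound hsolg hsolh hSmap hEB, aubinAt_of_eventually hSmap ?_⟩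
  -- The error bound for Γ comes first because it does not involve φ; it supplies the Lipschitz
  -- continuity of φ that the system for S needs.
  have hEBΓ := (gradientSystem_of_contDiff hg hh).exists_error_bound hy₀.1
    (fun i => (hg i).continuous.continuousAt) (hRS.comp_embedding Function.Embedding.some)
    (fun V hV => (hisc V hV).mono fun x ⟨y, hyS, hyV⟩ => ⟨y, hyS.1, hyV⟩)
  have hhL := fun j => (hh j).lipschitzInParameter x₀ y₀
  obtain ⟨L, hL, hLev⟩ := exists_abs_optimalValue_sub_le hf hφ hisc
    (exists_aubin_of_error_bound hEBΓ (fun i => (hg i).lipschitzInParameter x₀ y₀) hhL)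
  refine exists_aubin_of_error_bound hEB (fun i => ?_) hhL
  rcases i with _ | i
  · obtain ⟨A, hA, hAev⟩ := hf.lipschitzInParameter x₀ y₀
    have hp : Tendsto (fun p : Euc n × Euc n × Euc m => (p.1, p.2.1)) (𝓝 (x₀, x₀, y₀))
      (𝓝 (x₀, x₀)) := Continuous.tendsto (by fun_prop) (x₀, x₀, y₀)
    refine ⟨A + L, add_nonneg hA hL, ?_⟩
    filter_upwards [hAev, hp.eventually hLev] with p h1 h2
    have e1 := abs_le.1 h1
    have e2 := abs_le.1 h2
    simp only [realSolIneq, add_mul]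
    exact abs_le.2 ⟨by linarith, by linarith⟩
  · exact (hg i).lipschitzInParameter x₀ y₀

/-- Continuity of φ keeps it finite near x₀, so Γ(x) is nonempty and compact and S(x) is nonempty;
the convex projection argument then applies to the system describing S. -/
theorem eventually_nonempty_solutionMap_inter_of_convex
    (hf : ContDiff ℝ 1 (fun z : Euc n × Euc m => f z.1 z.2))
    (hg : ∀ i, ContDiff ℝ 1 (fun z : Euc n × Euc m => g i z.1 z.2))
    (hh : ∀ j, ContDiff ℝ 1 (fun z : Euc n × Euc m => h j z.1 z.2))
    (hfc : ∀ x, ConvexOn ℝ univ (f x)) (hgc : ∀ x i, ConvexOn ℝ univ (g i x))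
    (hha : ∀ x j, ∃ A : Euc m →ᵃ[ℝ] ℝ, ∀ y, h j x y = A y)
    (hbd : LocallyBoundedAt (feasibleMap g h) x₀)
    (hR : ∀ y ∈ solutionMap f g h x₀, RCPLDAt (solIneq f g h) (solEq h) x₀ y)
    (hφ₀ : ContinuousAt (optimalValue f g h) x₀) (hy₀ : y₀ ∈ solutionMap f g h x₀) :
    ∀ V ∈ 𝓝 y₀, ∀ᶠ x in 𝓝 x₀, (solutionMap f g h x ∩ V).Nonempty := by
  set φ : Euc n → ℝ := fun x => (optimalValue f g h x).toReal with hφdef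
  have hval := optimalValue_eq_of_mem_solutionMap hy₀
  have hφ : ∀ᶠ x in 𝓝 x₀, optimalValue f g h x = (φ x : EReal) := by
    have h1 := hφ₀.eventually_ne (y := ⊤) (by rw [hval]; exact EReal.coe_ne_top _)
    have h2 := hφ₀.eventually_ne (y := ⊥) (by rw [hval]; exact EReal.coe_ne_bot _)
    filter_upwards [h1, h2] with x hx1 hx2
    exact (EReal.coe_toReal hx1 hx2).symm
  have hφc : ContinuousAt φ x₀ :=
    (EReal.tendsto_toReal (by rw [hval]; exact EReal.coe_ne_top _)
      (by rw [hval]; exact EReal.coe_ne_bot _)).comp hφ₀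
  have hSsys := gradientSystem_realSolIneq φ hf hg hh
  have hΓsys := gradientSystem_of_contDiff hg hh
  have hsolg : ∀ᶠ x in 𝓝 x₀, ∀ i y, solIneq f g h i x y = (realSolIneq f φ g i x y : EReal) :=
    hφ.mono fun x hx i y => solIneq_eq_coe hx i y
  have hsolh : ∀ᶠ x in 𝓝 x₀, ∀ j y, solEq h j x y = (h j x y : EReal) :=
    Eventually.of_forall fun _ _ _ => rfl
  have hSmap : ∀ᶠ x in 𝓝 x₀, solutionMap f g h x = feasibleMap (realSolIneq f φ g) h x :=
    hφ.mono fun x hx => solutionMap_eq_feasibleMap hx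
  have hSmap₀ := hSmap.self_of_nhds
  obtain ⟨B, hB, W, hW, hWB⟩ := hbd
  have hne : ∀ᶠ x in 𝓝 x₀, (solutionMap f g h x).Nonempty := by
    filter_upwards [hφ, hW] with x hx hxW
    have hΓne : (feasibleMap g h x).Nonempty := by
      by_contra hemp
      rw [not_nonempty_iff_eq_empty] at hemp
      simp [optimalValue, hemp] at hx
    have hcomp : IsCompact (feasibleMap g h x) :=
      Metric.isCompact_of_isClosed_isBounded (hΓsys.isClosed x) (hB.subset (hWB x hxW))
    have hcont : Continuous (f x) := hf.continuous.comp (by fun_prop : Continuous fun y => (x, y))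
    obtain ⟨y, hy, hmin⟩ := hcomp.exists_isMinOn hΓne hcont.continuousOn
    exact ⟨y, hy, fun z hz => hmin hz⟩
  have key := hSsys.eventually_nonempty_inter_of_convex (x₀ := x₀) (y₀ := y₀)
    (fun i x => by
      rcases i with _ | i
      · exact (hfc x).add_const (-φ x)
      · exact hgc x i)
    (fun j x => by
      obtain ⟨A, hA⟩ := hha x j
      have hA' : h j x = id ∘ A := funext hA
      have hA'' : -h j x = id ∘ (-A) := by rw [hA']; rfl
      have hid := convexOn_id (𝕜 := ℝ) (β := ℝ) convex_univ
      exact ⟨by rw [hA']; exact hid.comp_affineMap A, by rw [hA'']; exact hid.comp_affineMap (-A)⟩)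
    hB
    (by
      filter_upwards [hSmap, hW] with x hx hxW
      rw [← hx]
      exact fun y hy => hWB x hxW hy.1)
    (by
      filter_upwards [hSmap, hne] with x hx hxne
      rwa [← hx])
    (fun i y => continuousAt_realSolIneq hφc hf hg i y)
    (fun j y => (hh j).continuous.continuousAt)
    (fun y hy => (hR y (hSmap₀ ▸ hy)).relaxedConstPosLinDep hSsys hsolg hsolh)
    (hSmap₀ ▸ hy₀)
  intro V hV
  filter_upwards [hSmap, key V hV] with x hx hxV
  rwa [hx]

end ParametricOptimization

theorem mainTheorem4 {n m ℓ q : ℕ}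
    (f : Euc n → Euc m → ℝ) (g : Fin ℓ → Euc n → Euc m → ℝ) (h : Fin q → Euc n → Euc m → ℝ)
    (hf : ContDiff ℝ 1 (fun z : Euc n × Euc m => f z.1 z.2))
    (hg : ∀ i, ContDiff ℝ 1 (fun z : Euc n × Euc m => g i z.1 z.2))
    (hh : ∀ j, ContDiff ℝ 1 (fun z : Euc n × Euc m => h j z.1 z.2))
    (x₀ : Euc n) (hx₀ : (feasibleMap g h x₀).Nonempty) :
    ((∀ x, ConvexOn ℝ Set.univ (f x)) →
      (∀ x, ∀ i, ConvexOn ℝ Set.univ (g i x)) →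
      (∀ x, ∀ j, ∃ A : Euc m →ᵃ[ℝ] ℝ, ∀ y, h j x y = A y) →
      LocallyBoundedAt (feasibleMap g h) x₀ →
      (∀ y ∈ solutionMap f g h x₀, RCPLDAt (solIneq f g h) (solEq h) x₀ y) →
      ContinuousAt (optimalValue f g h) x₀ →
      ∀ y ∈ solutionMap f g h x₀,
        RRegularAt (solutionMap f g h) (solIneq f g h) (solEq h) x₀ y ∧
        AubinAt (solutionMap f g h) x₀ y) ∧
    (∀ y ∈ solutionMap f g h x₀,
      InnerSemicontinuousAt (solutionMap f g h) x₀ y →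
      RCPLDAt (solIneq f g h) (solEq h) x₀ y →
        RRegularAt (solutionMap f g h) (solIneq f g h) (solEq h) x₀ y ∧
        AubinAt (solutionMap f g h) x₀ y) := by
  refine ⟨fun hfc hgc hha hbd hR hφ y hy => ?_, fun y hy hisc hR => ?_⟩
  · exact rRegularAt_and_aubinAt_of_innerSemicontinuous hf hg hh hy
      (eventually_nonempty_solutionMap_inter_of_convex hf hg hh hfc hgc hha hbd hR hφ hy) (hR y hy)
  · exact rRegularAt_and_aubinAt_of_innerSemicontinuous hf hg hh hy
      hisc.eventually_nonempty_inter hR
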